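/- Let $n>25$ be an integer, let $L\subset\mathbb R^n$ be a lattice with $\mathrm{covol}(L)=1$, and write $L=g\mathbb Z^n$ with $g\in GL_n(\mathbb R)$ (any such $g$ may be used). Let $\delta,\tau\in(0,1)$, and let $\mathcal K\subset\mathbb R^n$ be a bounded convex set with nonempty interior. Notation. For a lattice $L'$ in $\mathbb R^n$ put $$\eta(\mathcal K,L')=\sup_{x\in\mathbb R^n}\left|\frac{|L'\cap(\mathcal K+x)|}{\mathrm{vol}(\mathcal K)/\mathrm{covol}(L')}-1\right| .$$ Let $\rho_{\mathcal K}(L)$ be the ratio $\mathrm r_{\mathrm{cov}}/\mathrm r_{\mathrm{pack}}$, where $\mathrm r_{\mathrm{cov}}$ is the infimum of the $\alpha>0$ with $L+\alpha\mathcal K=\mathbb R^n$, and $\mathrm r_{\mathrm{pack}}$ is the supremum of the $\alpha>0$ for which the translates $\ell+\alpha\mathcal K$, $\ell\in L$, are pairwise disjoint. For a prime $p$, let $\mathrm{Gr}_{n,r}(\mathbb F_p)$ be the set of $r$-dimensional subspaces of $\mathbb F_p^n$ and $\pi_p:\mathbb Z^n\to\mathbb F_p^n$ the coordinatewise reduction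 modulo $p$. For $S\in\mathrm{Gr}_{n,r}(\mathbb F_p)$ put $L(S)=\frac1p\, g\,\pi_p^{-1}(S)$. Assume that $\rho_{\mathcal K}(L)\le\bar\rho$ for some real $\bar\rho$ with $1\le\bar\rho<\left(\frac2\delta\right)^{n/2}$, and that $$\mathrm{vol}(\mathcal K)>e\cdot128^3\;\bar\rho^{\,6}\left(\frac1{\tau\delta}\right)^6n^3 .$$ Let $p$ be any prime number with $$\max\left\{\frac{64\bar\rho^{\,2}n}{(\tau\delta)^2},\ \left((2.5)^{-n}\,\mathrm{vol}(\mathcal K)\right)^{1/3}\right\}<p<\left(e^{-1}\,\mathrm{vol}(\mathcal K)\right)^{1/3},$$ and let $r=3+\left\lceil\frac{n\log(3\bar\rho)}{\log p}\right\rceil$. Then $r<n$, every $S\in\mathrm{Gr}_{n,r}(\mathbb F_p)$ satisfies $\mathrm{covol}(p^{r/n}L(S))=1$, and for $S$ uniformly distributed on $\mathrm{Gr}_{n,r}(\mathbb F_p)$, $$\Pr\left(\eta(\mathcal K,p^{r/n}L(S))\ge2\tau\right)<2\delta .$$ -/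

import Mathlib

open Set MeasureTheory
open scoped Pointwise ENNReal

namespace SmoothCover

noncomputable section

/-- `N(L, K, x) = |L ∩ (K + x)|`, the number of points of `L` in the translate of `K` by `x`. -/
def pointCount {n : ℕ} (L : Submodule ℤ (EuclideanSpace ℝ (Fin n)))
    (K : Set (EuclideanSpace ℝ (Fin n))) (x : EuclideanSpace ℝ (Fin n)) : ℕ :=
  ((L : Set (EuclideanSpace ℝ (Fin n))) ∩ (x +ᵥ K)).ncard

/-- The covering smoothness `η(K, L) = sup_x |N(L, K, x) / (vol K / covol L) - 1|`.
The supremum is taken in `[0, ∞]`, so that it always exists. -/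
def coveringSmoothness {n : ℕ} (K : Set (EuclideanSpace ℝ (Fin n)))
    (L : Submodule ℤ (EuclideanSpace ℝ (Fin n))) : ℝ≥0∞ :=
  ⨆ x : EuclideanSpace ℝ (Fin n),
    ENNReal.ofReal |(pointCount L K x : ℝ) / (volume.real K / ZLattice.covolume L) - 1|

/-- `(L, K)` is a covering: `L + K = ℝⁿ`. -/
def IsCovering {n : ℕ} (L : Submodule ℤ (EuclideanSpace ℝ (Fin n)))
    (K : Set (EuclideanSpace ℝ (Fin n))) : Prop :=
  (L : Set (EuclideanSpace ℝ (Fin n))) + K = univ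

/-- `(L, K)` is a packing: the translates `ℓ + K`, `ℓ ∈ L`, are pairwise disjoint. -/
def IsPacking {n : ℕ} (L : Submodule ℤ (EuclideanSpace ℝ (Fin n)))
    (K : Set (EuclideanSpace ℝ (Fin n))) : Prop :=
  (L : Set (EuclideanSpace ℝ (Fin n))).PairwiseDisjoint fun l => l +ᵥ K

/-- The covering radius of `L` with respect to `K`. -/
def coveringRadius {n : ℕ} (K : Set (EuclideanSpace ℝ (Fin n)))
    (L : Submodule ℤ (EuclideanSpace ℝ (Fin n))) : ℝ :=
  sInf {α : ℝ | 0 < α ∧ IsCovering L (α • K)}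

/-- The packing radius of `L` with respect to `K`. -/
def packingRadius {n : ℕ} (K : Set (EuclideanSpace ℝ (Fin n)))
    (L : Submodule ℤ (EuclideanSpace ℝ (Fin n))) : ℝ :=
  sSup {α : ℝ | 0 < α ∧ IsPacking L (α • K)}

/-- The ratio `ρ_K(L)` of the covering radius to the packing radius. -/
def coverPackRatio {n : ℕ} (K : Set (EuclideanSpace ℝ (Fin n)))
    (L : Submodule ℤ (EuclideanSpace ℝ (Fin n))) : ℝ :=
  coveringRadius K L / packingRadius K L

/-- The Grassmannian of `r`-dimensional subspaces of `𝔽_pⁿ`. -/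
def Gr (p n r : ℕ) : Type :=
  {S : Submodule (ZMod p) (Fin n → ZMod p) // Module.finrank (ZMod p) S = r}

/-- Coordinatewise reduction modulo `p`, from `ℤⁿ` to `𝔽_pⁿ`. -/
def reduction (p n : ℕ) : (Fin n → ℤ) →ₗ[ℤ] (Fin n → ZMod p) :=
  (Int.castAddHom (ZMod p)).toIntLinearMap.compLeft (Fin n)

/-- The lattice `L(S) = (1/p) g π_p⁻¹(S)`, where `L = g ℤⁿ` and the columns of `g` are the
vectors of the `ℤ`-basis `b` of `L`. -/
def superLattice {p n r : ℕ} {L : Submodule ℤ (EuclideanSpace ℝ (Fin n))}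
    (b : Module.Basis (Fin n) ℤ L) (S : Gr p n r) :
    Submodule ℤ (EuclideanSpace ℝ (Fin n)) :=
  (p : ℝ)⁻¹ • ((S.1.restrictScalars ℤ).comap (reduction p n)).map
    (L.subtype ∘ₗ b.equivFun.symm.toLinearMap)

/-- The probability that `S ∈ E`, for `S` uniformly distributed on the finite set
`Gr p n r`. -/
def uniformProb {p n r : ℕ} (E : Set (Gr p n r)) : ℝ :=
  (Nat.card E : ℝ) / (Nat.card (Gr p n r) : ℝ)

end

end SmoothCover

/-! Put `s = p / p ^ (r / n)`. Up to scaling by `s`, the points of `p ^ (r / n) • L(S)` in `x + K`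
are the points of `g π_p⁻¹(S)` in a translate of `s K`. The number `α` is slightly larger than the
upper bound for the covering radius, and `n α ≤ (τ / 6) s`. Hence every translate of `s K` lies
between translates of `(s - α) K` and `(s + α) K` by vectors of `L`, at the cost of a factor `1 +
O(τ)`. The choice of `r` makes reduction mod `p` injective on `L ∩ (s ± α) K`. A count at a vector
of `L` thus becomes the count of a fixed finite set `A ⊆ 𝔽_pⁿ` in a coset of `S`, where `|A| ≥ p ^
(m + 1)` and `m = n + 2 - r`.

What remains is a statement over finite fields (`card_bad_lt`): for all but a proportion `δ` of the
`S`, every coset of `S` contains nearly its share of `A`. It is applied to two sets `A`, whence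
`2δ`. A variance bound controls only most cosets; a Kakeya argument reaches all of them. Write `S =
ψ⁻¹(span(u, v))` with `ψ : 𝔽_pⁿ → 𝔽_p^m` a random surjection and `(u, v)` a random independent pair,
and let `μ = |A| / p ^ m ≥ p` be the mean size of `A` on a fibre of `ψ`. Call a point of `𝔽_p^m` bad
if its fibre count is far from `μ`.

By the second moment over `ψ`, bad points are rare on average (`sum_card_badCells_le`). If some
coset of `S` has the wrong count, the same argument, conditional on `S` and inside that coset, shows
that for at least half of the `(ψ, u, v)` representing `S` a plane parallel to `u, v` consists
almost entirely of bad points (`card_fiber_le_two_mul`). If many `S` failed, then for many `ψ` such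
planes would exist in a positive proportion of directions. A Kakeya bound for planes
(`card_pow_le_of_planes`) would make at least a third of `𝔽_p^m` bad for those `ψ`, which
contradicts rarity.

The Kakeya bound is the polynomial method with multiplicities. A low-degree `P` vanishing to high
order on the bad set has a top-degree part vanishing to order `l` at `u + T v` over `𝔽_p[T]` for
every rich direction. These are points of a grid of side `p ^ 2`, and Schwartz–Zippel with
multiplicities (`card_mul_sum_order_le`) excludes too many of them. -/

namespace SmoothCover

/-! ### Orders of vanishing and the Schwartz–Zippel lemma with multiplicities. -/

section Multiplicity

open MvPolynomial

variable {σ R A : Type*} [CommRing R] [CommRing A]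

/-- The polynomial `P(X + a)`. -/
noncomputable def shift (a : σ → R) : MvPolynomial σ R →ₐ[R] MvPolynomial σ R :=
  aeval fun i => X i + C (a i)

/-- `P` vanishes at `a` to order at least `M`: its expansion around `a` has no term of degree
less than `M`. -/
def VanishesToOrder (P : MvPolynomial σ R) (a : σ → R) (M : ℕ) : Prop :=
  ∀ i : σ →₀ ℕ, i.degree < M → coeff i (shift a P) = 0

@[simp] lemma shift_X (a : σ → R) (i : σ) : shift a (X i) = X i + C (a i) := by simp [shift]

@[simp] lemma shift_C (a : σ → R) (c : R) : shift a (C c) = C c := by simp [shift]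

lemma shift_shift (a b : σ → R) (P : MvPolynomial σ R) :
    shift a (shift b P) = shift (a + b) P := by
  have : (shift a).comp (shift b) = shift (a + b) := by
    ext i; simp [add_assoc]
  exact DFunLike.congr_fun this P

lemma map_shift (f : R →+* A) (a : σ → R) (P : MvPolynomial σ R) :
    map f (shift a P) = shift (fun i => f (a i)) (map f P) := by
  have : (map f).comp (shift a).toRingHom =
      (shift fun i => f (a i)).toRingHom.comp (map f : MvPolynomial σ R →+* _) := by
    apply MvPolynomial.ringHom_ext <;> intro i <;> simp
  exact DFunLike.congr_fun this P

lemma shift_neg_shift (a : σ → R) (P : MvPolynomial σ R) : shift (-a) (shift a P) = P := by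
  rw [shift_shift, neg_add_cancel]
  have : shift (0 : σ → R) = AlgHom.id R _ := by ext i; simp
  simp [this]

lemma shift_ne_zero {a : σ → R} {P : MvPolynomial σ R} (h : P ≠ 0) : shift a P ≠ 0 := by
  intro h0
  apply h
  rw [← shift_neg_shift a P, h0, map_zero]

lemma finSuccEquiv_shift {n : ℕ} (b : R) (a : Fin n → R) (P : MvPolynomial (Fin (n + 1)) R) :
    finSuccEquiv R n (shift (Fin.cons b a) P) =
      Polynomial.taylor (C b) (Polynomial.map (shift a).toRingHom (finSuccEquiv R n P)) := by
  have : (finSuccEquiv R n).toRingEquiv.toRingHom.comp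
        (shift (Fin.cons b a : Fin (n + 1) → R)).toRingHom =
      ((Polynomial.compRingHom (Polynomial.X + Polynomial.C (C b))).comp
        (Polynomial.mapRingHom (shift a).toRingHom)).comp
          (finSuccEquiv R n).toRingEquiv.toRingHom := by
    apply MvPolynomial.ringHom_ext
    · intro r
      simp [finSuccEquiv_apply]
    · intro i
      refine Fin.cases ?_ (fun j => ?_) i
      · simp [finSuccEquiv_apply]
      · simp [finSuccEquiv_apply]
  exact DFunLike.congr_fun this P

lemma coeff_taylor_eq_sum {B : Type*} [CommRing B] (f : Polynomial B) (r : B) (k N : ℕ)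
    (hN : f.natDegree < N) :
    (Polynomial.taylor r f).coeff k =
      ∑ i ∈ Finset.range N, (i.choose k : B) * f.coeff i * r ^ (i - k) := by
  rw [Polynomial.taylor_coeff, Polynomial.hasseDeriv_apply, Polynomial.sum_over_range' _ _ N hN,
    Polynomial.eval_finsetSum]
  · simp
  · simp

/-- Taking a fixed coefficient of the coefficients of a univariate polynomial. -/
noncomputable def coeffwise (i : σ →₀ ℕ) (F : Polynomial (MvPolynomial σ R)) : Polynomial R :=
  ∑ j ∈ Finset.range (F.natDegree + 1), Polynomial.monomial j (coeff i (F.coeff j))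

lemma coeff_coeffwise (i : σ →₀ ℕ) (F : Polynomial (MvPolynomial σ R)) (j : ℕ) :
    (coeffwise i F).coeff j = coeff i (F.coeff j) := by
  simp only [coeffwise, Polynomial.finsetSum_coeff, Polynomial.coeff_monomial,
    Finset.sum_ite_eq', Finset.mem_range]
  split_ifs with h
  · rfl
  · rw [Polynomial.coeff_eq_zero_of_natDegree_lt (by omega), coeff_zero]

lemma natDegree_coeffwise_le (i : σ →₀ ℕ) (F : Polynomial (MvPolynomial σ R)) :
    (coeffwise i F).natDegree ≤ F.natDegree := by
  rw [Polynomial.natDegree_le_iff_coeff_eq_zero]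
  intro N hN
  rw [coeff_coeffwise, Polynomial.coeff_eq_zero_of_natDegree_lt hN, coeff_zero]

/-- The centre `C b` is constant in the remaining variables, so extracting a coefficient there
commutes with the Taylor shift in the first variable. This reduces the induction step below to one
variable. -/
lemma coeff_taylor_coeffwise (i : σ →₀ ℕ) (F : Polynomial (MvPolynomial σ R)) (b : R) (k : ℕ) :
    coeff i ((Polynomial.taylor (C b) F).coeff k) =
      (Polynomial.taylor b (coeffwise i F)).coeff k := by
  rw [coeff_taylor_eq_sum F _ _ _ (Nat.lt_succ_self _),
    coeff_taylor_eq_sum _ b k (F.natDegree + 1) (by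
      have := natDegree_coeffwise_le i F; omega), coeff_sum]
  refine Finset.sum_congr rfl fun j _ => ?_
  rw [coeff_coeffwise, ← C_pow, mul_comm, coeff_C_mul, ← map_natCast (C : R →+* MvPolynomial σ R),
    coeff_C_mul]
  ring

/-- Undoing the Taylor shift turns divisibility by `X ^ ν b` into divisibility by `(X - b) ^ ν b`; a
nonzero polynomial has at most its degree many roots with multiplicity. -/
lemma sum_le_natDegree_of_forall_coeff_taylor [IsDomain R] (Q : Polynomial R) (hQ : Q ≠ 0)
    (S : Finset R) (ν : R → ℕ)
    (h : ∀ b ∈ S, ∀ k < ν b, (Polynomial.taylor b Q).coeff k = 0) :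
    ∑ b ∈ S, ν b ≤ Q.natDegree := by
  classical
  calc ∑ b ∈ S, ν b ≤ ∑ b ∈ S, Q.roots.count b := by
        refine Finset.sum_le_sum fun b hb => ?_
        rw [Polynomial.count_roots, Polynomial.le_rootMultiplicity_iff hQ]
        have h1 : (Polynomial.X : Polynomial R) ^ ν b ∣ Polynomial.taylor b Q :=
          Polynomial.X_pow_dvd_iff.2 (h b hb)
        have h2 := map_dvd (Polynomial.taylorAlgHom (-b)) h1
        simpa [Polynomial.taylor_taylor, sub_eq_add_neg] using h2
    _ ≤ Multiset.card Q.roots := by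
        rw [← Multiset.toFinset_sum_count_eq]
        refine Finset.sum_le_sum_of_ne_zero fun x _ hx => ?_
        rw [Multiset.mem_toFinset, ← Multiset.count_ne_zero]
        exact hx
    _ ≤ Q.natDegree := Polynomial.card_roots' Q

/-- The Schwartz-Zippel lemma with multiplicities: the orders of vanishing of a nonzero polynomial
of degree `d` in `m` variables on a grid `S ^ m` add up to at most `d |S| ^ (m - 1)`. -/
theorem card_mul_sum_order_le [IsDomain R] (S : Finset R) :
    ∀ {m : ℕ} (P : MvPolynomial (Fin m) R), P ≠ 0 → ∀ ν : (Fin m → R) → ℕ,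
      (∀ x ∈ Fintype.piFinset fun _ : Fin m => S, VanishesToOrder P x (ν x)) →
      S.card * ∑ x ∈ Fintype.piFinset (fun _ : Fin m => S), ν x ≤ P.totalDegree * S.card ^ m := by
  intro m
  induction m with
  | zero =>
    intro P hP ν h
    have h0 : ∀ x ∈ Fintype.piFinset fun _ : Fin 0 => S, ν x = 0 := by
      intro x hx
      by_contra hν
      apply shift_ne_zero (a := x) hP
      ext i
      rw [Subsingleton.elim i 0, coeff_zero]
      exact h x hx 0 (by simpa using Nat.pos_of_ne_zero hν)
    rw [Finset.sum_eq_zero h0]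
    simp
  | succ m ih =>
    intro P hP ν h
    classical
    set F := finSuccEquiv R m P with hF
    have hF0 : F ≠ 0 := by simpa [hF] using hP
    set t := F.natDegree with ht
    have hlead : F.leadingCoeff ≠ 0 := Polynomial.leadingCoeff_ne_zero.2 hF0
    have hdeg : F.leadingCoeff.totalDegree + t ≤ P.totalDegree :=
      totalDegree_coeff_finSuccEquiv_add_le P t hlead
    -- `ι a` is a lowest-degree exponent in the expansion of the leading coefficient at `a`; its
    -- degree is the exact order of vanishing there and is what the induction hypothesis is fed.
    have hmin : ∀ a : Fin m → R, ∃ i : Fin m →₀ ℕ, coeff i (shift a F.leadingCoeff) ≠ 0 ∧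
        ∀ j : Fin m →₀ ℕ, j.degree < i.degree → coeff j (shift a F.leadingCoeff) = 0 := by
      intro a
      obtain ⟨i0, hi0⟩ := exists_coeff_ne_zero (shift_ne_zero (a := a) hlead)
      obtain ⟨i, hi, hi'⟩ := (measure fun i : Fin m →₀ ℕ => i.degree).wf.has_min
        {i | coeff i (shift a F.leadingCoeff) ≠ 0} ⟨i0, hi0⟩
      refine ⟨i, hi, fun j hj => ?_⟩
      by_contra hne
      exact hi' j hne hj
    choose ι hι hιmin using hmin
    have hfib : ∀ a ∈ Fintype.piFinset fun _ : Fin m => S,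
        ∑ b ∈ S, ν (Fin.cons b a) ≤ S.card * (ι a).degree + t := by
      intro a ha
      set G := Polynomial.map (shift a).toRingHom F with hG
      -- `Q` collects the terms with exponent `ι a` in the last `m` variables. Its degree is exactly
      -- `t`, since its coefficient at `t` is the one chosen nonzero.
      set Q := coeffwise (ι a) G with hQ
      have hQt : Q.coeff t ≠ 0 := by
        rw [hQ, coeff_coeffwise, hG, Polynomial.coeff_map]
        exact hι a
      have hQ0 : Q ≠ 0 := by
        rintro h0
        exact hQt (by rw [h0, Polynomial.coeff_zero])
      have hQdeg : Q.natDegree ≤ t :=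
        (natDegree_coeffwise_le _ _).trans Polynomial.natDegree_map_le
      have hsum : ∑ b ∈ S, (ν (Fin.cons b a) - (ι a).degree) ≤ Q.natDegree := by
        refine sum_le_natDegree_of_forall_coeff_taylor Q hQ0 S _ fun b hb k hk => ?_
        -- The `k`-th Taylor coefficient of `Q` at `b` is the coefficient of `P` around `(b, a)` in
        -- degree `k + |ι a|`, hence zero below order `ν`; the order drops by at most `|ι a|`.
        rw [hQ, ← coeff_taylor_coeffwise, hG, ← finSuccEquiv_shift, finSuccEquiv_coeff_coeff]
        refine h (Fin.cons b a) ?_ _ ?_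
        · rw [Fintype.mem_piFinset] at ha ⊢
          exact fun i => Fin.cases hb ha i
        · have : (Finsupp.cons k (ι a)).degree = k + (ι a).degree := by
            rw [Finsupp.degree_eq_sum, Finsupp.degree_eq_sum, Fin.sum_univ_succ]
            simp
          omega
      calc ∑ b ∈ S, ν (Fin.cons b a)
          ≤ ∑ b ∈ S, ((ι a).degree + (ν (Fin.cons b a) - (ι a).degree)) :=
            Finset.sum_le_sum fun b _ => by omega
        _ ≤ S.card * (ι a).degree + t := by
            rw [Finset.sum_add_distrib, Finset.sum_const, smul_eq_mul]
            omega
    have hsplit : ∑ x ∈ Fintype.piFinset (fun _ : Fin (m + 1) => S), ν x =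
        ∑ a ∈ Fintype.piFinset (fun _ : Fin m => S), ∑ b ∈ S, ν (Fin.cons b a) := by
      rw [Finset.sum_comm, ← Finset.sum_product']
      symm
      refine Finset.sum_bij (fun y _ => Fin.cons y.1 y.2) ?_ ?_ ?_ ?_
      · intro y hy
        rw [Finset.mem_product, Fintype.mem_piFinset] at hy
        rw [Fintype.mem_piFinset]
        exact fun i => Fin.cases hy.1 hy.2 i
      · intro y _ z _ hyz
        obtain ⟨h1, h2⟩ := Fin.cons_injective2 hyz
        exact Prod.ext h1 h2
      · intro x hx
        rw [Fintype.mem_piFinset] at hx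
        exact ⟨(x 0, Fin.tail x), by
          rw [Finset.mem_product, Fintype.mem_piFinset]
          exact ⟨hx 0, fun i => hx i.succ⟩, Fin.cons_self_tail x⟩
      · intro y _
        rfl
    have hind := ih F.leadingCoeff hlead (fun a => (ι a).degree) fun a _ j hj => hιmin a j hj
    calc S.card * ∑ x ∈ Fintype.piFinset (fun _ : Fin (m + 1) => S), ν x
        ≤ S.card * ∑ a ∈ Fintype.piFinset (fun _ : Fin m => S), (S.card * (ι a).degree + t) := by
          rw [hsplit]
          exact Nat.mul_le_mul_left _ (Finset.sum_le_sum hfib)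
      _ = S.card * (S.card * ∑ a ∈ Fintype.piFinset (fun _ : Fin m => S), (ι a).degree) +
            S.card * (S.card ^ m * t) := by
          rw [Finset.sum_add_distrib, ← Finset.mul_sum, Finset.sum_const, smul_eq_mul,
            Fintype.card_piFinset_const, Nat.mul_add]
      _ ≤ S.card * (F.leadingCoeff.totalDegree * S.card ^ m) + S.card * (S.card ^ m * t) := by
          gcongr
      _ = (F.leadingCoeff.totalDegree + t) * S.card ^ (m + 1) := by ring
      _ ≤ P.totalDegree * S.card ^ (m + 1) := by gcongr

end Multiplicity

/-! ### Restricting a polynomial to a plane and passing to its top-degree part. -/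

section PlaneKakeya

open MvPolynomial

variable {σ τ R : Type*} [CommRing R]

/-- Translation changes a monomial only by terms of strictly smaller degree, as induction on the
degree shows by splitting off one variable. -/
lemma coeff_shift_monomial_of_degree_le (a : σ → R) (s i : σ →₀ ℕ) (h : s.degree ≤ i.degree) :
    coeff i (shift a (monomial s (1 : R))) = coeff i (monomial s (1 : R)) := by
  classical
  induction hn : s.degree generalizing s i with
  | zero =>
    rw [Finsupp.degree_eq_zero_iff] at hn
    subst hn
    simp [shift]
  | succ n ih =>
    obtain ⟨k, hk⟩ : ∃ k, s k ≠ 0 := by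
      by_contra! h0
      have : s = 0 := Finsupp.ext h0
      simp [this] at hn
    obtain ⟨s', rfl⟩ : ∃ s', s = s' + Finsupp.single k 1 := by
      refine ⟨s - Finsupp.single k 1, ?_⟩
      rw [tsub_add_cancel_of_le]
      simpa [Nat.one_le_iff_ne_zero] using hk
    have hs' : s'.degree = n := by
      simpa [map_add] using hn
    have hmon : monomial (s' + Finsupp.single k 1) (1 : R) = monomial s' 1 * X k := by
      rw [X, monomial_mul, one_mul]
    have hi : n + 1 ≤ i.degree := by omega
    have hne : s' ≠ i := by
      rintro rfl
      omega
    rw [hmon, map_mul, shift_X, mul_add, coeff_add, coeff_mul_X', coeff_mul_X', mul_comm _ (C _),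
      coeff_C_mul, ih s' i (by omega) hs', coeff_monomial i s', if_neg hne, mul_zero,
      add_zero]
    split_ifs with hki
    · refine ih s' _ ?_ hs'
      have h1 : i = i - Finsupp.single k 1 + Finsupp.single k 1 := by
        rw [tsub_add_cancel_of_le]
        simpa [Nat.one_le_iff_ne_zero] using hki
      have h2 := congrArg Finsupp.degree h1
      simp only [map_add, Finsupp.degree_single] at h2
      omega
    · rfl

lemma coeff_shift_of_totalDegree_le (a : σ → R) (P : MvPolynomial σ R) (i : σ →₀ ℕ)
    (h : P.totalDegree ≤ i.degree) : coeff i (shift a P) = coeff i P := by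
  conv_lhs => rw [P.as_sum]
  conv_rhs => rw [P.as_sum]
  rw [map_sum, coeff_sum, coeff_sum]
  refine Finset.sum_congr rfl fun s hs => ?_
  have h1 : monomial s (coeff s P) = C (coeff s P) * monomial s 1 := by
    rw [C_mul_monomial, mul_one]
  rw [h1, map_mul, shift_C, coeff_C_mul, coeff_C_mul, coeff_shift_monomial_of_degree_le]
  exact (le_totalDegree hs).trans h

lemma coeff_shift_eq_zero (a : σ → R) (P : MvPolynomial σ R) (i : σ →₀ ℕ)
    (h : P.totalDegree < i.degree) : coeff i (shift a P) = 0 := by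
  rw [coeff_shift_of_totalDegree_le a P i h.le]
  exact coeff_eq_zero_of_totalDegree_lt h

/-- All monomials of `H`, a polynomial in two sets of variables, have total degree in `D`. -/
def JointDegree (D : Set ℕ) (H : MvPolynomial σ (MvPolynomial τ R)) : Prop :=
  ∀ i j, coeff j (coeff i H) ≠ 0 → i.degree + j.degree ∈ D

lemma JointDegree.sum {ι : Type*} {D : Set ℕ} (s : Finset ι)
    (H : ι → MvPolynomial σ (MvPolynomial τ R)) (h : ∀ k ∈ s, JointDegree D (H k)) :
    JointDegree D (∑ k ∈ s, H k) := by
  intro i j hij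
  rw [coeff_sum, coeff_sum] at hij
  obtain ⟨k, hk, hne⟩ := Finset.exists_ne_zero_of_sum_ne_zero hij
  exact h k hk i j hne

lemma JointDegree.mul {k l : ℕ} {G H : MvPolynomial σ (MvPolynomial τ R)}
    (hG : JointDegree {k} G) (hH : JointDegree {l} H) : JointDegree {k + l} (G * H) := by
  classical
  intro i j hij
  rw [coeff_mul, coeff_sum] at hij
  obtain ⟨⟨i1, i2⟩, hi, hne⟩ := Finset.exists_ne_zero_of_sum_ne_zero hij
  rw [coeff_mul] at hne
  obtain ⟨⟨j1, j2⟩, hj, hne'⟩ := Finset.exists_ne_zero_of_sum_ne_zero hne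
  have hi' : i1 + i2 = i := by simpa using hi
  have hj' : j1 + j2 = j := by simpa using hj
  have h1 := hG i1 j1 (left_ne_zero_of_mul hne')
  have h2 := hH i2 j2 (right_ne_zero_of_mul hne')
  simp only [Set.mem_singleton_iff] at h1 h2 ⊢
  rw [← hi', ← hj', map_add, map_add]
  omega

lemma jointDegree_C_C (c : R) : JointDegree {0} (C (C c) : MvPolynomial σ (MvPolynomial τ R)) := by
  classical
  intro i j hij
  rw [coeff_C] at hij
  split_ifs at hij with hi
  · rw [coeff_C] at hij
    split_ifs at hij with hj
    · simp [← hi, ← hj]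
    · exact absurd rfl hij
  · simp at hij

lemma JointDegree.pow {k : ℕ} {G : MvPolynomial σ (MvPolynomial τ R)}
    (hG : JointDegree {k} G) (e : ℕ) : JointDegree {e * k} (G ^ e) := by
  induction e with
  | zero => simpa using jointDegree_C_C (σ := σ) (τ := τ) (1 : R)
  | succ e ih =>
    rw [pow_succ, Nat.succ_mul]
    exact ih.mul hG

lemma JointDegree.prod {ι : Type*} (s : Finset ι) (e : ι → ℕ)
    (G : ι → MvPolynomial σ (MvPolynomial τ R)) (h : ∀ k ∈ s, JointDegree {e k} (G k)) :
    JointDegree {∑ k ∈ s, e k} (∏ k ∈ s, G k) := by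
  classical
  induction s using Finset.induction_on with
  | empty => simpa using jointDegree_C_C (σ := σ) (τ := τ) (1 : R)
  | insert k s hk ih =>
    rw [Finset.prod_insert hk, Finset.sum_insert hk]
    exact (h k (Finset.mem_insert_self _ _)).mul
      (ih fun k' hk' => h k' (Finset.mem_insert_of_mem hk'))

lemma jointDegree_X_add_C (k : σ) {L : MvPolynomial τ R} (hL : L.IsHomogeneous 1) :
    JointDegree {1} (X k + C L) := by
  classical
  intro i j hij
  rw [coeff_add, coeff_add, coeff_X, coeff_C] at hij
  by_cases hi : Finsupp.single k 1 = i
  · subst hi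
    have h0 : (0 : σ →₀ ℕ) ≠ Finsupp.single k 1 := by
      intro h
      simpa using DFunLike.congr_fun h k
    rw [if_pos rfl, if_neg h0, coeff_zero, add_zero, coeff_one] at hij
    split_ifs at hij with hj
    · simp [← hj]
    · exact absurd rfl hij
  · rw [if_neg hi, coeff_zero, zero_add] at hij
    split_ifs at hij with hi0
    · subst hi0
      have := hL.coeff_eq_zero (d := j)
      simp only [map_zero, zero_add, Set.mem_singleton_iff]
      by_contra hne
      exact hij (this hne)
    · simp at hij

/-- Substituting `X + L` with `L` linear in the second variables preserves total degree monomial by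
monomial. Taking for `D` an upper range, a lower range or a single value handles degree bounds,
vanishing orders and homogeneous parts at once. -/
lemma jointDegree_shift {D : Set ℕ} (P : MvPolynomial σ R) (hP : ∀ i ∈ P.support, i.degree ∈ D)
    (L : σ → MvPolynomial τ R) (hL : ∀ k, (L k).IsHomogeneous 1) :
    JointDegree D (shift L (map C P)) := by
  have hsum : shift L (map C P) =
      ∑ i ∈ P.support, C (C (coeff i P)) * ∏ k ∈ i.support, (X k + C (L k)) ^ i k := by
    conv_lhs => rw [P.as_sum]
    rw [map_sum, map_sum]
    refine Finset.sum_congr rfl fun i _ => ?_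
    rw [map_monomial, monomial_eq, map_mul, shift_C, Finsupp.prod, map_prod]
    simp
  rw [hsum]
  refine JointDegree.sum _ _ fun i hi => ?_
  have h1 := (jointDegree_C_C (σ := σ) (τ := τ) (coeff i P)).mul
    (JointDegree.prod i.support (fun k => i k * 1) (fun k => (X k + C (L k)) ^ i k)
      fun k _ => (jointDegree_X_add_C k (hL k)).pow (i k))
  intro i' j' hne
  have h2 := h1 i' j' hne
  simp only [Set.mem_singleton_iff, mul_one, zero_add] at h2
  rw [h2]
  exact hP i hi

/-- Moving the parameters of the plane by `z` amounts to moving the base point of `P` by the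
corresponding vector `w`. Thus the coefficients at `z` see the behaviour of `P` at a point of the
plane. -/
lemma shift_coeff_shift (z : τ → R) (L : σ → MvPolynomial τ R) (w : σ → R)
    (hw : ∀ k, shift z (L k) = C (w k) + L k) (P : MvPolynomial σ R) (i : σ →₀ ℕ) :
    shift z (coeff i (shift L (map C P))) = coeff i (shift L (map C (shift w P))) := by
  have h1 : (shift z).toRingHom.comp (C : R →+* MvPolynomial τ R) = C := by
    ext c
    simp
  have h2 : (fun k => (shift z).toRingHom (L k)) = L + fun k => C (w k) := by
    funext k
    rw [Pi.add_apply, add_comm, ← hw k]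
    rfl
  calc shift z (coeff i (shift L (map C P)))
      = coeff i (map (shift z).toRingHom (shift L (map C P))) :=
        (coeff_map (shift z).toRingHom _ i).symm
    _ = coeff i (shift L (map C (shift w P))) := by
        rw [map_shift, map_map, h1, h2, map_shift C w, shift_shift]

/-- Specialise the two plane parameters to `(1, T)`. -/
lemma vanishesToOrder_of_coeff_shift_eq_zero (P : MvPolynomial σ R) (u v : σ → R) (l : ℕ)
    (h : ∀ i : σ →₀ ℕ, i.degree < l → coeff i (shift
      (fun k => (C (u k) * X 0 + C (v k) * X 1 : MvPolynomial (Fin 2) R)) (map C P)) = 0) :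
    VanishesToOrder (map Polynomial.C P)
      (fun k => Polynomial.C (u k) + Polynomial.C (v k) * Polynomial.X) l := by
  intro i hi
  let φ : MvPolynomial (Fin 2) R →+* Polynomial R :=
    eval₂Hom Polynomial.C ![1, Polynomial.X]
  have h1 : φ.comp C = Polynomial.C := by
    ext c
    simp [φ]
  have h2 : (fun k => φ (C (u k) * X 0 + C (v k) * X 1)) =
      fun k => Polynomial.C (u k) + Polynomial.C (v k) * Polynomial.X := by
    funext k
    simp [φ]
  have h5 := congrArg φ (h i hi)
  rw [map_zero, ← coeff_map, map_shift, map_map, h1, h2] at h5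
  exact h5

/-- If `P` vanishes to order `M` at many points of the plane `{a + s u + t v}`, then the top
degree part of `P` vanishes to order `l` at the generic direction `u + T v` of the plane. -/
lemma homogeneousComponent_vanishesToOrder {F : Type*} [Field F] [Fintype F]
    {m : ℕ} {P : MvPolynomial (Fin m) F} {a u v : Fin m → F} {Z : Finset (Fin 2 → F)} {d l M : ℕ}
    (hdeg : P.totalDegree = d)
    (hZ : ∀ z ∈ Z, VanishesToOrder P (a + (z 0 • u + z 1 • v)) M)
    (hlt : d * Fintype.card F < Z.card * (M - l)) :
    VanishesToOrder (map Polynomial.C (homogeneousComponent d P))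
      (fun k => Polynomial.C (u k) + Polynomial.C (v k) * Polynomial.X) l := by
  classical
  set L : Fin m → MvPolynomial (Fin 2) F := fun k => C (u k) * X 0 + C (v k) * X 1 with hL
  have hL1 : ∀ k, (L k).IsHomogeneous 1 := fun k =>
    ((isHomogeneous_X F 0).C_mul (u k)).add ((isHomogeneous_X F 1).C_mul (v k))
  -- `H` is `P(a + X + s u + t v)` expanded in `X`, with coefficients in `F[s, t]`.
  set H := shift L (map C (shift a P)) with hH
  have hshift : ∀ i (z : Fin 2 → F), shift z (coeff i H) =
      coeff i (shift L (map C (shift (a + (z 0 • u + z 1 • v)) P))) := by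
    intro i z
    have hz : ∀ k, shift z (L k) = C ((z 0 • u + z 1 • v) k) + L k := by
      intro k
      simp only [hL, map_add, map_mul, shift_C, shift_X, Pi.add_apply, Pi.smul_apply, smul_eq_mul]
      ring
    rw [hH, shift_coeff_shift z L _ hz, shift_shift, add_comm a]
  have hzero : ∀ i : Fin m →₀ ℕ, i.degree < l → coeff i H = 0 := by
    intro i hi
    by_contra hne
    have hjd : JointDegree {k | k ≤ d} H := jointDegree_shift _ (fun j hj => by
      by_contra hlt'
      rw [mem_support_iff] at hj
      exact hj (coeff_shift_eq_zero a P j (by simpa [hdeg] using hlt'))) L hL1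
    have htd : (coeff i H).totalDegree ≤ d := by
      refine Finset.sup_le fun j hj => ?_
      have := hjd i j (mem_support_iff.1 hj)
      simp only [Set.mem_ofPred_eq] at this
      change j.degree ≤ d
      omega
    -- For `|i| < l` the coefficient of `X ^ i` has degree at most `d` in `(s, t)` and vanishes to
    -- order `M - l` on `Z`: a term of joint degree at least `M` uses fewer than `l` of it in `X`.
    -- Schwartz–Zippel in two variables and `hlt` make it zero.
    have hsz := card_mul_sum_order_le (Finset.univ : Finset F) (coeff i H) hne
      (fun z => if z ∈ Z then M - l else 0) (by
        intro z _ j hj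
        split_ifs at hj with hz
        · rw [hshift]
          by_contra hne'
          have hge : JointDegree {k | M ≤ k}
              (shift L (map C (shift (a + (z 0 • u + z 1 • v)) P))) :=
            jointDegree_shift _ (fun j hj => by
              by_contra hlt'
              rw [mem_support_iff] at hj
              exact hj (hZ z hz j (by simpa using hlt'))) L hL1
          have := hge i j hne'
          simp only [Set.mem_ofPred_eq] at this
          omega
        · omega)
    rw [Fintype.piFinset_univ, Finset.sum_ite_mem, Finset.univ_inter, Finset.sum_const,
      smul_eq_mul, Finset.card_univ] at hsz
    have hq : 0 < Fintype.card F := Fintype.card_pos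
    have h3 : Fintype.card F * (Z.card * (M - l)) ≤ Fintype.card F * (d * Fintype.card F) := by
      calc _ ≤ _ := hsz
        _ ≤ d * Fintype.card F ^ 2 := by gcongr
        _ = _ := by ring
    exact absurd (Nat.le_of_mul_le_mul_left h3 hq) (by omega)
  have htop : ∀ i : Fin m →₀ ℕ, i.degree < l →
      coeff i (shift L (map C (homogeneousComponent d P))) = 0 := by
    intro i hi
    ext j
    rw [coeff_zero]
    by_contra hne
    have h1 : JointDegree {d} (shift L (map C (homogeneousComponent d P))) :=
      jointDegree_shift _ (fun k hk => by
        by_contra hne'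
        rw [mem_support_iff, coeff_homogeneousComponent] at hk
        exact hk (if_neg hne')) L hL1
    -- Replacing `P(a + ·)` by its top-degree part alters only joint degrees below `d`, so the part
    -- of `H` of joint degree `d` comes from the top-degree part alone and vanishes with `H`.
    have h2 : JointDegree {k | k < d}
        (shift L (map C (shift a P - homogeneousComponent d P))) :=
      jointDegree_shift _ (fun k hk => by
        by_contra hlt'
        rw [mem_support_iff, coeff_sub, coeff_homogeneousComponent] at hk
        simp only [Set.mem_ofPred_eq, not_lt] at hlt'
        apply hk
        rw [coeff_shift_of_totalDegree_le a P k (by omega)]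
        split_ifs with hkd
        · exact sub_self _
        · rw [sub_zero]
          exact coeff_eq_zero_of_totalDegree_lt (by
            change _ < k.degree
            omega)) L hL1
    have h3 := h1 i j hne
    have h4 : coeff j (coeff i (shift L (map C (shift a P - homogeneousComponent d P)))) = 0 := by
      by_contra hne'
      have := h2 i j hne'
      simp only [Set.mem_ofPred_eq, Set.mem_singleton_iff] at this h3
      omega
    rw [map_sub, map_sub, coeff_sub, coeff_sub, ← hH, hzero i hi, coeff_zero, zero_sub,
      neg_eq_zero] at h4
    exact hne h4
  exact vanishesToOrder_of_coeff_shift_eq_zero _ u v l htop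

end PlaneKakeya

/-! ### The robust Kakeya bound for planes. -/

section PlaneKakeya

open MvPolynomial

/-- Homogenise: a slack coordinate `d - |i|` turns exponents of degree at most `d` into exponents of
degree exactly `d` in one more variable. -/
lemma natCard_degree_le (m d : ℕ) :
    Nat.card {i : Fin m →₀ ℕ // i.degree ≤ d} = (d + m).choose m := by
  have h := Finset.card_finsuppAntidiag_nat_eq_choose (s := (Finset.univ : Finset (Fin (m + 1)))) d
  rw [Finset.card_univ, Fintype.card_fin, show m + 1 + d - 1 = d + m by omega,
    Nat.choose_symm_add] at h
  rw [← h, ← Nat.card_eq_finsetCard]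
  have hdeg : ∀ (k : ℕ) (i : Fin m →₀ ℕ), (Finsupp.cons k i).degree = k + i.degree := by
    intro k i
    rw [Finsupp.degree_eq_sum, Finsupp.degree_eq_sum, Fin.sum_univ_succ]
    simp
  have hmem : ∀ f : Fin (m + 1) →₀ ℕ, f ∈ Finset.univ.finsuppAntidiag d ↔ f.degree = d := by
    intro f
    simp [Finset.mem_finsuppAntidiag, Finsupp.degree_eq_sum]
  refine Nat.card_congr
    { toFun := fun i => ⟨Finsupp.cons (d - i.1.degree) i.1, by
        rw [hmem, hdeg]
        have := i.2
        omega⟩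
      invFun := fun f => ⟨Finsupp.tail f.1, by
        have h1 := (hmem f.1).1 f.2
        have h2 := hdeg (f.1 0) (Finsupp.tail f.1)
        rw [Finsupp.cons_tail] at h2
        omega⟩
      left_inv := fun i => by
        ext1
        simp
      right_inv := fun f => by
        ext1
        have h1 := (hmem f.1).1 f.2
        have h2 := hdeg (f.1 0) (Finsupp.tail f.1)
        rw [Finsupp.cons_tail] at h2
        have h3 : d - (Finsupp.tail f.1).degree = f.1 0 := by omega
        change Finsupp.cons (d - (Finsupp.tail f.1).degree) (Finsupp.tail f.1) = f.1
        rw [h3, Finsupp.cons_tail] }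

/-- Vanishing to order `M + 1` at one point is `(M + m).choose m` linear conditions, and polynomials
of degree at most `d` form a space of dimension `(d + m).choose m`. -/
lemma exists_vanishesToOrder {F : Type*} [Field F] {m d M : ℕ} (Y : Finset (Fin m → F))
    (h : Y.card * (M + m).choose m < (d + m).choose m) :
    ∃ P : MvPolynomial (Fin m) F, P ≠ 0 ∧ P.totalDegree ≤ d ∧
      ∀ y ∈ Y, VanishesToOrder P y (M + 1) := by
  have hfin : ∀ k, Finite {i : Fin m →₀ ℕ // i.degree ≤ k} := fun k =>
    (Nat.card_ne_zero.1 (by rw [natCard_degree_le]; exact (Nat.choose_pos (by omega)).ne')).2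
  have := hfin M
  have := Fintype.ofFinite {i : Fin m →₀ ℕ // i.degree ≤ M}
  let T : restrictTotalDegree (Fin m) F d →ₗ[F]
      (Y × {i : Fin m →₀ ℕ // i.degree ≤ M} → F) :=
    { toFun := fun P y => coeff y.2.1 (shift y.1.1 P.1)
      map_add' := fun P Q => by
        funext y
        simp
      map_smul' := fun c P => by
        funext y
        simp }
  have hdim : Module.finrank F (restrictTotalDegree (Fin m) F d) = (d + m).choose m := by
    rw [restrictTotalDegree, Module.finrank_eq_nat_card_basis (basisRestrictSupport F _),
      ← natCard_degree_le]
    rfl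
  have hker : LinearMap.ker T ≠ ⊥ := by
    apply LinearMap.ker_ne_bot_of_finrank_lt
    rw [hdim, Module.finrank_fintype_fun_eq_card, Fintype.card_prod, Fintype.card_coe,
      ← Nat.card_eq_fintype_card (α := {i : Fin m →₀ ℕ // i.degree ≤ M}), natCard_degree_le]
    exact h
  obtain ⟨P, hP, hP0⟩ := Submodule.exists_mem_ne_zero_of_ne_bot hker
  refine ⟨P.1, fun h0 => hP0 (Subtype.ext h0), (mem_restrictTotalDegree _ _ _).1 P.2,
    fun y hy i hi => ?_⟩
  exact congrFun (LinearMap.mem_ker.1 hP) (⟨y, hy⟩, ⟨i, by omega⟩)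

/-- A robust Kakeya bound for planes: if for all `(u, v) ∈ E` some plane parallel to `u` and `v`
has at least `g` of its points in `Y`, then `Y` is large. -/
theorem choose_le_card_mul_choose {F : Type*} [Field F] [Fintype F] [DecidableEq F] {m : ℕ}
    (Y : Finset (Fin m → F)) (E : Finset ((Fin m → F) × (Fin m → F))) (g d l M : ℕ)
    (hE : ∀ w ∈ E, ∃ a : Fin m → F,
      g ≤ (Finset.univ.filter fun z : Fin 2 → F => a + (z 0 • w.1 + z 1 • w.2) ∈ Y).card)
    (h1 : d * Fintype.card F ^ (2 * m) < Fintype.card F ^ 2 * l * E.card)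
    (h2 : d * Fintype.card F < g * (M + 1 - l)) :
    (d + m).choose m ≤ Y.card * (M + m).choose m := by
  by_contra! hlt
  obtain ⟨P, hP0, hPd, hPY⟩ := exists_vanishesToOrder Y hlt
  set q := Fintype.card F with hq
  set d' := P.totalDegree with hd'
  set P' := map Polynomial.C (homogeneousComponent d' P) with hP'
  have hP'0 : P' ≠ 0 := by
    rw [hP', Ne, map_eq_zero_iff _ (map_injective _ Polynomial.C_injective)]
    obtain ⟨s, hs, hsd⟩ := Finset.exists_mem_eq_sup P.support
      (by simpa [Finset.nonempty_iff_ne_empty] using hP0) (fun s => s.sum fun _ e => e)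
    intro h0
    have := congrArg (coeff s) h0
    rw [coeff_homogeneousComponent, if_pos, coeff_zero] at this
    · exact (mem_support_iff.1 hs) this
    · exact hsd.symm
  have hP'd : P'.totalDegree ≤ d := by
    refine (Finset.sup_mono (support_map_subset _ _)).trans ?_
    exact (homogeneousComponent_isHomogeneous d' P).totalDegree_le.trans hPd
  -- The grid consists of the polynomials `a + b T`. A pair `(u, v)` is encoded injectively as the
  -- grid point `u + T v`; the side `q ^ 2` instead of `q` allows a degree of order `n ^ 2 q`.
  set S : Finset (Polynomial F) := Finset.univ.image
    (fun z : F × F => Polynomial.C z.1 + Polynomial.C z.2 * Polynomial.X) with hS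
  have hinj : ∀ a b a' b' : F, Polynomial.C a + Polynomial.C b * Polynomial.X =
      Polynomial.C a' + Polynomial.C b' * Polynomial.X → a = a' ∧ b = b' := by
    intro a b a' b' h
    have h0 := congrArg (fun f => Polynomial.coeff f 0) h
    have h1 := congrArg (fun f => Polynomial.coeff f 1) h
    simp only [Polynomial.coeff_add, Polynomial.coeff_C_zero, Polynomial.coeff_mul_X_zero,
      Polynomial.coeff_C_succ, Polynomial.coeff_mul_X, add_zero, zero_add] at h0 h1
    exact ⟨h0, h1⟩
  have hScard : S.card = q ^ 2 := by
    rw [hS, Finset.card_image_of_injective, Finset.card_univ, Fintype.card_prod, sq]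
    intro z z' h
    exact Prod.ext_iff.2 (hinj _ _ _ _ h)
  let w : (Fin m → F) × (Fin m → F) → Fin m → Polynomial F :=
    fun e k => Polynomial.C (e.1 k) + Polynomial.C (e.2 k) * Polynomial.X
  have hw : Function.Injective w := by
    intro e e' h
    have := fun k => hinj _ _ _ _ (congrFun h k)
    exact Prod.ext (funext fun k => (this k).1) (funext fun k => (this k).2)
  have hwS : ∀ e, w e ∈ Fintype.piFinset fun _ : Fin m => S := by
    intro e
    rw [Fintype.mem_piFinset]
    intro k
    exact Finset.mem_image.2 ⟨(e.1 k, e.2 k), Finset.mem_univ _, rfl⟩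
  have hsz := card_mul_sum_order_le S P' hP'0 (fun x => if x ∈ E.image w then l else 0) (by
    intro x _
    split_ifs with hx
    · obtain ⟨e, he, rfl⟩ := Finset.mem_image.1 hx
      obtain ⟨a, ha⟩ := hE e he
      refine homogeneousComponent_vanishesToOrder (M := M + 1) (a := a)
        (Z := Finset.univ.filter fun z : Fin 2 → F => a + (z 0 • e.1 + z 1 • e.2) ∈ Y) rfl ?_ ?_
      · intro z hz
        exact hPY _ (Finset.mem_filter.1 hz).2
      · calc d' * Fintype.card F ≤ d * Fintype.card F := by gcongr
          _ < g * (M + 1 - l) := h2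
          _ ≤ _ := by gcongr
    · intro i hi
      omega)
  rw [Finset.sum_ite_mem, Finset.inter_eq_right.2 (by
    intro x hx
    obtain ⟨e, _, rfl⟩ := Finset.mem_image.1 hx
    exact hwS e), Finset.sum_const, smul_eq_mul, Finset.card_image_of_injective _ hw,
    hScard] at hsz
  have h3 : P'.totalDegree * (q ^ 2) ^ m ≤ d * q ^ (2 * m) := by
    rw [← pow_mul]
    gcongr
  have h4 : q ^ 2 * (E.card * l) = q ^ 2 * l * E.card := by ring
  omega

/-- After multiplication by `m!` both sides are products of `m` factors; each factor loses at most
`1 + 1 / n`, and `(1 + 1 / n) ^ n ≤ e < 3`. -/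
lemma pow_mul_choose_le (q n m a b : ℕ) (hmn : m ≤ n) (hn : 0 < n)
    (h : (q : ℝ) * (a + m) ≤ (1 + 1 / n) * b) :
    (q : ℝ) ^ m * (a + m).choose m ≤ 3 * (b + m).choose m := by
  have hfac : (0 : ℝ) < m.factorial := by positivity
  have hprod : ∀ c : ℕ, (m.factorial : ℝ) * (c + m).choose m =
      ∏ j ∈ Finset.range m, ((c : ℝ) + 1 + j) := by
    intro c
    have := (Nat.ascFactorial_eq_factorial_mul_choose c m).symm.trans
      (Nat.ascFactorial_eq_prod_range (c + 1) m)
    exact_mod_cast this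
  have hexp : (1 + 1 / (n : ℝ)) ^ m ≤ 3 := by
    have hn' : (0 : ℝ) < n := by exact_mod_cast hn
    calc (1 + 1 / (n : ℝ)) ^ m ≤ (1 + 1 / (n : ℝ)) ^ n := by
          apply pow_le_pow_right₀ _ hmn
          have : (0 : ℝ) < 1 / n := by positivity
          linarith
      _ ≤ Real.exp (1 / n) ^ n := by
          gcongr
          rw [add_comm]
          exact Real.add_one_le_exp _
      _ = Real.exp 1 := by
          rw [← Real.exp_nat_mul]
          congr 1
          field_simp
      _ ≤ 3 := by
          have := Real.exp_one_lt_d9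
          linarith
  have hkey : (q : ℝ) ^ m * ∏ j ∈ Finset.range m, ((a : ℝ) + 1 + j) ≤
      (1 + 1 / (n : ℝ)) ^ m * ∏ j ∈ Finset.range m, ((b : ℝ) + 1 + j) := by
    have hpow : ∀ x : ℝ, x ^ m = ∏ _j ∈ Finset.range m, x := fun x => by simp
    rw [hpow, hpow, ← Finset.prod_mul_distrib, ← Finset.prod_mul_distrib]
    refine Finset.prod_le_prod (fun j _ => by positivity) fun j hj => ?_
    have hj' : (j : ℝ) + 1 ≤ m := by exact_mod_cast Finset.mem_range.1 hj
    calc (q : ℝ) * (a + 1 + j) ≤ q * (a + m) :=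
          mul_le_mul_of_nonneg_left (by linarith) (Nat.cast_nonneg q)
      _ ≤ (1 + 1 / n) * b := h
      _ ≤ (1 + 1 / n) * (b + 1 + j) := by gcongr; linarith
  have h2 : (m.factorial : ℝ) * ((q : ℝ) ^ m * (a + m).choose m) ≤
      m.factorial * (3 * (b + m).choose m) := by
    calc (m.factorial : ℝ) * ((q : ℝ) ^ m * (a + m).choose m)
        = (q : ℝ) ^ m * (m.factorial * (a + m).choose m) := by ring
      _ ≤ (1 + 1 / (n : ℝ)) ^ m * (m.factorial * (b + m).choose m) := by
          rw [hprod, hprod]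
          exact hkey
      _ ≤ 3 * (m.factorial * (b + m).choose m) := by gcongr
      _ = _ := by ring
  exact le_of_mul_le_mul_left h2 hfac

theorem card_pow_le_of_planes {F : Type*} [Field F] [Fintype F] [DecidableEq F] {m n : ℕ}
    (hmn : m ≤ n) (hn : 0 < n) (Y : Finset (Fin m → F))
    (E : Finset ((Fin m → F) × (Fin m → F))) {δ : ℝ}
    (hq : 64 * n ≤ δ * Fintype.card F)
    (hE : ∀ w ∈ E, ∃ a : Fin m → F, (1 - 1 / (4 * n)) * (Fintype.card F : ℝ) ^ 2 ≤
      (Finset.univ.filter fun z : Fin 2 → F => a + (z 0 • w.1 + z 1 • w.2) ∈ Y).card)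
    (hEcard : δ / 8 * (Fintype.card F : ℝ) ^ (2 * m) < E.card) :
    (Fintype.card F : ℝ) ^ m ≤ 3 * Y.card := by
  set q := Fintype.card F with hqdef
  have hq0 : (0 : ℝ) < q := by exact_mod_cast (Fintype.card_pos : 0 < Fintype.card F)
  have hn1 : (1 : ℝ) ≤ n := by exact_mod_cast hn
  have hn0 : (0 : ℝ) < n := by linarith
  set g := ⌈(1 - 1 / (4 * n)) * (q : ℝ) ^ 2⌉₊ with hg
  have hgle : (1 - 1 / (4 * n)) * (q : ℝ) ^ 2 ≤ g := Nat.le_ceil _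
  -- Here `d = 8 n² q`, `l = n`, `M = 8 n² + 5 n`. The loss `1 / (4n)` is affordable because `(1 -
  -- 1/(4n)) (M + 1 - l) = 8 n² + 2 n - 1/(4n) > 8 n²`, while `q (M + m) ≤ (1 + 1/n) d` keeps the
  -- ratio of binomials near `q ^ m`.
  have hmain := choose_le_card_mul_choose Y E g (8 * n ^ 2 * q) n (8 * n ^ 2 + 5 * n)
    (fun w hw => by
      obtain ⟨a, ha⟩ := hE w hw
      exact ⟨a, Nat.ceil_le.2 ha⟩)
    (by
      rw [← hqdef]
      have h1 : ((8 * n ^ 2 * q * q ^ (2 * m) : ℕ) : ℝ) < ((q ^ 2 * n * E.card : ℕ) : ℝ) := by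
        push_cast
        calc (8 * n ^ 2 * q * q ^ (2 * m) : ℝ) = (64 * n) * (n * q * (q ^ (2 * m) / 8)) := by ring
          _ ≤ (δ * q) * (n * q * (q ^ (2 * m) / 8)) := by gcongr
          _ = q ^ 2 * n * (δ / 8 * q ^ (2 * m)) := by ring
          _ < q ^ 2 * n * E.card := by gcongr
      exact_mod_cast h1)
    (by
      rw [← hqdef, show 8 * n ^ 2 + 5 * n + 1 - n = 8 * n ^ 2 + 4 * n + 1 by omega]
      have h1 : ((8 * n ^ 2 * q * q : ℕ) : ℝ) < ((g * (8 * n ^ 2 + 4 * n + 1) : ℕ) : ℝ) := by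
        push_cast
        calc (8 * n ^ 2 * q * q : ℝ) < (8 * n ^ 2 + 2 * n - 1 / (4 * n)) * q ^ 2 := by
              have : 1 / (4 * (n : ℝ)) ≤ 1 := by
                rw [div_le_one (by positivity)]
                linarith
              nlinarith [mul_pos hq0 hq0]
          _ = (1 - 1 / (4 * n)) * q ^ 2 * (8 * n ^ 2 + 4 * n + 1) := by
              field_simp
              ring
          _ ≤ g * (8 * n ^ 2 + 4 * n + 1) := by gcongr
      exact_mod_cast h1)
  have h3 := pow_mul_choose_le q n m (8 * n ^ 2 + 5 * n) (8 * n ^ 2 * q) hmn hn (by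
    have hm : (m : ℝ) ≤ n := by exact_mod_cast hmn
    push_cast
    have h5 : (q : ℝ) * (8 * (n : ℝ) ^ 2 + 5 * n + m) ≤ q * (8 * (n : ℝ) ^ 2 + 8 * n) :=
      mul_le_mul_of_nonneg_left (by linarith) hq0.le
    refine h5.trans (le_of_eq ?_)
    field_simp)
  have hC : (0 : ℝ) < (8 * n ^ 2 * q + m).choose m := by
    exact_mod_cast Nat.choose_pos (by omega)
  have hC' : (0 : ℝ) < (8 * n ^ 2 + 5 * n + m).choose m := by
    exact_mod_cast Nat.choose_pos (by omega)
  have h4 : ((8 * n ^ 2 * q + m).choose m : ℝ) ≤ Y.card * (8 * n ^ 2 + 5 * n + m).choose m := by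
    exact_mod_cast hmain
  refine le_of_mul_le_mul_right ?_ hC'
  linarith

end PlaneKakeya

/-! ### The variance of fibre counts. -/

section SecondMoment

open Finset in
/-- Under pairwise almost independence, the fibres of a random map have small variance. -/
lemma sum_sum_sq_card_fiber_sub_le {α V W : Type*} [DecidableEq V] [DecidableEq W]
    (T : Finset α) (h : α → V → W) (B : Finset V) (C : α → Finset W) (Q : ℕ) (hQ : 0 < Q)
    (hmap : ∀ t ∈ T, ∀ x ∈ B, h t x ∈ C t) (hC : ∀ t ∈ T, #(C t) = Q)
    (hcoll : ∀ x ∈ B, ∀ x' ∈ B, x ≠ x' → Q * #{t ∈ T | h t x = h t x'} ≤ #T) :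
    ∑ t ∈ T, ∑ y ∈ C t, ((#{x ∈ B | h t x = y} : ℝ) - (#B : ℝ) / Q) ^ 2 ≤ (#T : ℝ) * #B := by
  classical
  have hQ' : (0 : ℝ) < Q := by exact_mod_cast hQ
  have hinner : ∀ t ∈ T, ∑ y ∈ C t, ((#{x ∈ B | h t x = y} : ℝ) - (#B : ℝ) / Q) ^ 2 =
      ∑ x ∈ B, ∑ x' ∈ B, (if h t x = h t x' then (1 : ℝ) else 0) - (#B : ℝ) ^ 2 / Q := by
    intro t ht
    have h1 : ∑ y ∈ C t, (#{x ∈ B | h t x = y} : ℝ) = #B := by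
      exact_mod_cast (card_eq_sum_card_fiberwise (hmap t ht)).symm
    have h2 : ∑ y ∈ C t, (#{x ∈ B | h t x = y} : ℝ) ^ 2 =
        ∑ x ∈ B, ∑ x' ∈ B, (if h t x = h t x' then (1 : ℝ) else 0) := by
      rw [← sum_fiberwise_of_maps_to (hmap t ht)]
      refine sum_congr rfl fun y _ => ?_
      rw [sq, ← nsmul_eq_mul, ← sum_const]
      refine sum_congr rfl fun x hx => ?_
      rw [sum_boole]
      congr 2
      ext x'
      rw [mem_filter, mem_filter, (mem_filter.1 hx).2, eq_comm]
    have h3 : ∀ y, ((#{x ∈ B | h t x = y} : ℝ) - (#B : ℝ) / Q) ^ 2 =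
        (#{x ∈ B | h t x = y} : ℝ) ^ 2 - 2 * ((#B : ℝ) / Q) * #{x ∈ B | h t x = y} +
          ((#B : ℝ) / Q) ^ 2 := fun y => by ring
    rw [sum_congr rfl fun y _ => h3 y, sum_add_distrib, sum_sub_distrib, ← mul_sum, h1, h2,
      sum_const, hC t ht, nsmul_eq_mul]
    field_simp
    ring
  -- The term `#T / Q` is allowed on the diagonal too: summed over all pairs it then cancels the
  -- squared mean exactly, leaving only `#T * #B`.
  have hpair : ∀ x ∈ B, ∀ x' ∈ B, ∑ t ∈ T, (if h t x = h t x' then (1 : ℝ) else 0) ≤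
      (if x = x' then (#T : ℝ) else 0) + #T / Q := by
    intro x hx x' hx'
    rw [sum_boole]
    split_ifs with hxx
    · have h1 : (#{t ∈ T | h t x = h t x'} : ℝ) ≤ #T := by exact_mod_cast card_filter_le _ _
      have h2 : (0 : ℝ) ≤ #T / Q := by positivity
      linarith
    · rw [zero_add, le_div_iff₀ hQ', mul_comm]
      exact_mod_cast hcoll x hx x' hx' hxx
  calc ∑ t ∈ T, ∑ y ∈ C t, ((#{x ∈ B | h t x = y} : ℝ) - (#B : ℝ) / Q) ^ 2
      = ∑ t ∈ T, ∑ x ∈ B, ∑ x' ∈ B, (if h t x = h t x' then (1 : ℝ) else 0) -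
          #T * ((#B : ℝ) ^ 2 / Q) := by
        rw [sum_congr rfl hinner, sum_sub_distrib, sum_const, nsmul_eq_mul]
    _ = ∑ x ∈ B, ∑ x' ∈ B, ∑ t ∈ T, (if h t x = h t x' then (1 : ℝ) else 0) -
          #T * ((#B : ℝ) ^ 2 / Q) := by
        rw [sum_comm]
        congr 1
        exact sum_congr rfl fun x _ => sum_comm
    _ ≤ ∑ x ∈ B, ∑ x' ∈ B, ((if x = x' then (#T : ℝ) else 0) + #T / Q) -
          #T * ((#B : ℝ) ^ 2 / Q) := by
        gcongr with x hx x' hx'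
        exact hpair x hx x' hx'
    _ = (#T : ℝ) * #B := by
        have h1 : ∀ x ∈ B, ∑ x' ∈ B, ((if x = x' then (#T : ℝ) else 0) + #T / Q) =
            #T + #B * (#T / Q) := by
          intro x hx
          rw [sum_add_distrib, sum_ite_eq, if_pos hx, sum_const, nsmul_eq_mul]
        rw [sum_congr rfl h1, sum_const, nsmul_eq_mul]
        field_simp
        ring

end SecondMoment

/-! ### Flags and their symmetry under the general linear group. -/

section Flags

variable {F V W : Type*} [Field F] [AddCommGroup V] [Module F V] [AddCommGroup W] [Module F W]

/-- The subspace `ψ⁻¹(span(u, v))` attached to `(ψ, u, v)`. -/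
def flagSpace (ω : (V →ₗ[F] W) × W × W) : Submodule F V :=
  (Submodule.span F {ω.2.1, ω.2.2}).comap ω.1

/-- A random flag is given by a surjection `ψ` and an independent pair of vectors. -/
def IsFlag (ω : (V →ₗ[F] W) × W × W) : Prop :=
  Function.Surjective ω.1 ∧ LinearIndependent F ![ω.2.1, ω.2.2]

/-- Precomposing `ψ` with `g⁻¹` permutes flags and carries `S` to `g S` and `y` to `g y`. Every
equidistribution statement about flags follows from this symmetry and the transitivity lemmas below.
-/
lemma natCard_flag_eq (g : V ≃ₗ[F] V) (S : Submodule F V) (y : V) :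
    Nat.card {ω : (V →ₗ[F] W) × W × W // IsFlag ω ∧ flagSpace ω = S ∧ ω.1 y = 0} =
      Nat.card {ω : (V →ₗ[F] W) × W × W // IsFlag ω ∧ flagSpace ω = S.map g.toLinearMap ∧
        ω.1 (g y) = 0} := by
  let e : ((V →ₗ[F] W) × W × W) ≃ ((V →ₗ[F] W) × W × W) :=
    Equiv.prodCongr (LinearEquiv.congrLeft W F g).toEquiv (Equiv.refl _)
  have he : ∀ ω, (e ω).1 = ω.1 ∘ₗ g.symm.toLinearMap := fun ω => rfl
  have he2 : ∀ ω, (e ω).2 = ω.2 := fun ω => rfl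
  refine Nat.card_congr (e.subtypeEquiv fun ω => ?_)
  have h1 : IsFlag (e ω) ↔ IsFlag ω := by
    simp only [IsFlag, he, he2]
    refine and_congr ?_ Iff.rfl
    exact g.symm.surjective.of_comp_iff ω.1
  have h2 : flagSpace (e ω) = (flagSpace ω).map g.toLinearMap := by
    ext x
    simp only [flagSpace, he, he2, Submodule.mem_comap, Submodule.mem_map]
    constructor
    · intro hx
      exact ⟨g.symm x, hx, by simp⟩
    · rintro ⟨z, hz, rfl⟩
      simpa using hz
  have h3 : (e ω).1 (g y) = ω.1 y := by simp [he]
  rw [h1, h2, h3, (Submodule.map_injective_of_injective g.injective).eq_iff]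

lemma exists_linearEquiv_apply_eq [FiniteDimensional F V] {y y' : V} (hy : y ≠ 0) (hy' : y' ≠ 0) :
    ∃ g : V ≃ₗ[F] V, g y = y' := by
  obtain ⟨g, hg⟩ := Submodule.exists_linearEquiv_restrict_eq
    ((LinearEquiv.toSpanNonzeroSingleton F V y hy).symm.trans
      (LinearEquiv.toSpanNonzeroSingleton F V y' hy'))
  refine ⟨g, ?_⟩
  rw [← hg ⟨y, Submodule.mem_span_singleton_self y⟩]
  have : (LinearEquiv.toSpanNonzeroSingleton F V y hy).symm
      ⟨y, Submodule.mem_span_singleton_self y⟩ = 1 := by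
    rw [LinearEquiv.symm_apply_eq, LinearEquiv.toSpanNonzeroSingleton_one]
  rw [LinearEquiv.trans_apply, this, LinearEquiv.toSpanNonzeroSingleton_one]

/-- The stabiliser of `S` is still transitive on nonzero vectors of `S`: extend an automorphism of
`S` to `V`. This gives independence conditional on `S`. -/
lemma exists_linearEquiv_map_eq_apply_eq [FiniteDimensional F V] {S : Submodule F V} {y y' : V}
    (hyS : y ∈ S) (hyS' : y' ∈ S) (hy : y ≠ 0) (hy' : y' ≠ 0) :
    ∃ g : V ≃ₗ[F] V, S.map g.toLinearMap = S ∧ g y = y' := by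
  obtain ⟨f, hf⟩ := exists_linearEquiv_apply_eq (F := F) (V := S) (y := ⟨y, hyS⟩)
    (y' := ⟨y', hyS'⟩) (by simpa using hy) (by simpa using hy')
  obtain ⟨g, hg⟩ := Submodule.exists_linearEquiv_restrict_eq f
  refine ⟨g, ?_, ?_⟩
  · apply le_antisymm
    · rintro _ ⟨x, hx, rfl⟩
      change g x ∈ S
      rw [← hg ⟨x, hx⟩]
      exact (f _).2
    · intro x hx
      refine ⟨f.symm ⟨x, hx⟩, (f.symm _).2, ?_⟩
      change g _ = x
      rw [← hg, LinearEquiv.apply_symm_apply]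
  · rw [← hg ⟨y, hyS⟩, hf]

lemma exists_linearEquiv_map_eq [FiniteDimensional F V] {S S' : Submodule F V}
    (h : Module.finrank F S = Module.finrank F S') :
    ∃ g : V ≃ₗ[F] V, S.map g.toLinearMap = S' := by
  let f : S ≃ₗ[F] S' := LinearEquiv.ofFinrankEq S S' h
  obtain ⟨g, hg⟩ := Submodule.exists_linearEquiv_restrict_eq f
  refine ⟨g, le_antisymm ?_ ?_⟩
  · rintro _ ⟨x, hx, rfl⟩
    change g x ∈ S'
    rw [← hg ⟨x, hx⟩]
    exact (f _).2
  · intro x hx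
    refine ⟨f.symm ⟨x, hx⟩, (f.symm _).2, ?_⟩
    change g _ = x
    rw [← hg, LinearEquiv.apply_symm_apply]

lemma finrank_flagSpace [FiniteDimensional F V] [FiniteDimensional F W]
    {ω : (V →ₗ[F] W) × W × W} (h : IsFlag ω) :
    Module.finrank F (flagSpace ω) + Module.finrank F W = Module.finrank F V + 2 := by
  have h2 : Module.finrank F (Submodule.span F {ω.2.1, ω.2.2}) = 2 := by
    have := finrank_span_eq_card h.2
    rw [Matrix.range_cons_cons_empty] at this
    simpa using this
  have h3 := LinearMap.finrank_range_add_finrank_ker (ω.1.domRestrict (flagSpace ω))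
  have h4 := LinearMap.finrank_range_add_finrank_ker ω.1
  have h5 : Module.finrank F (LinearMap.range (ω.1.domRestrict (flagSpace ω))) = 2 := by
    rw [LinearMap.range_domRestrict, flagSpace, Submodule.map_comap_eq_of_surjective h.1, h2]
  have h6 : Module.finrank F (LinearMap.ker (ω.1.domRestrict (flagSpace ω))) =
      Module.finrank F (LinearMap.ker ω.1) := by
    have hle : LinearMap.ker ω.1 ≤ flagSpace ω := LinearMap.ker_le_comap _
    rw [LinearMap.ker_domRestrict]
    exact (Submodule.comapSubtypeEquivOfLe hle).finrank_eq
  rw [LinearMap.range_eq_top.2 h.1, finrank_top] at h4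
  omega

open Finset in
-- Double count the pairs `(t, y)` with `ψ t y = 0`. All nonzero `y` are killed equally often, so
-- each is killed with probability `(K - 1) / (K Q - 1) ≤ 1 / Q`.
lemma mul_card_filter_apply_eq_zero_le {α : Type*} [Fintype V] [DecidableEq V] [DecidableEq W]
    (T : Finset α) (ψ : α → V →ₗ[F] W) (S : Finset V) (K Q : ℕ) (hS0 : (0 : V) ∈ S)
    (hS : #S = K * Q) (hker : ∀ t ∈ T, #{y ∈ S | ψ t y = 0} = K)
    (hconst : ∀ y ∈ S, ∀ y' ∈ S, y ≠ 0 → y' ≠ 0 →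
      #{t ∈ T | ψ t y = 0} = #{t ∈ T | ψ t y' = 0}) {y : V} (hy : y ∈ S) (hy0 : y ≠ 0) :
    Q * #{t ∈ T | ψ t y = 0} ≤ #T := by
  have h1 : ∑ x ∈ S, #{t ∈ T | ψ t x = 0} = #T * K := by
    calc ∑ x ∈ S, #{t ∈ T | ψ t x = 0} = ∑ t ∈ T, #{x ∈ S | ψ t x = 0} := by
          simp only [card_filter]
          exact sum_comm
      _ = #T * K := by rw [sum_congr rfl hker, sum_const, smul_eq_mul]
  have h2 : ∑ x ∈ S, #{t ∈ T | ψ t x = 0} = #T + (K * Q - 1) * #{t ∈ T | ψ t y = 0} := by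
    rw [← add_sum_erase S _ hS0]
    congr 1
    · simp
    · rw [sum_congr rfl fun x hx => hconst x (mem_of_mem_erase hx) y hy (ne_of_mem_erase hx) hy0,
        sum_const, card_erase_of_mem hS0, hS, smul_eq_mul]
  have h3 : 1 < K * Q := by
    rw [← hS, one_lt_card]
    exact ⟨0, hS0, y, hy, hy0.symm⟩
  have hQ : 0 < Q := Nat.pos_of_ne_zero (by rintro rfl; omega)
  obtain ⟨k, hk⟩ : ∃ k, K = k + 1 := ⟨K - 1, by
    have : K ≠ 0 := by rintro rfl; omega
    omega⟩
  obtain ⟨j, hj⟩ : ∃ j, K * Q = j + 1 := ⟨K * Q - 1, by omega⟩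
  rw [h2, hj, hk, Nat.add_sub_cancel] at h1
  have h4 : j * #{t ∈ T | ψ t y = 0} = #T * k := by
    have : #T * (k + 1) = #T + #T * k := by ring
    omega
  have hj0 : 0 < j := by omega
  have h5 : Q * k ≤ j := by
    have : (k + 1) * Q = Q * k + Q := by ring
    rw [hk, this] at hj
    omega
  refine Nat.le_of_mul_le_mul_left ?_ hj0
  calc j * (Q * #{t ∈ T | ψ t y = 0}) = Q * (j * #{t ∈ T | ψ t y = 0}) := by ring
    _ = Q * k * #T := by rw [h4]; ring
    _ ≤ j * #T := by gcongr

end Flags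

/-! ### Equidistribution of a large set among all cosets of a random subspace. -/

section Hashing

open Finset
open scoped Classical

variable {F : Type*} [Field F] [Fintype F] {n m : ℕ}

/-- The finite set of flags `(ψ, u, v)`. -/
noncomputable def flags (F : Type*) [Field F] [Fintype F] (n m : ℕ) :
    Finset (((Fin n → F) →ₗ[F] (Fin m → F)) × (Fin m → F) × (Fin m → F)) :=
  letI : Finite ((Fin n → F) →ₗ[F] (Fin m → F)) := DFunLike.finite _
  {ω | IsFlag ω}.toFinite.toFinset

lemma mem_flags {ω : ((Fin n → F) →ₗ[F] (Fin m → F)) × (Fin m → F) × (Fin m → F)} :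
    ω ∈ flags F n m ↔ IsFlag ω := by
  simp [flags]

lemma card_filter_flags (S : Submodule F (Fin n → F)) (y : Fin n → F) :
    #{ω ∈ {ω ∈ flags F n m | flagSpace ω = S} | ω.1 y = 0} =
      Nat.card {ω : ((Fin n → F) →ₗ[F] (Fin m → F)) × (Fin m → F) × (Fin m → F) //
        IsFlag ω ∧ flagSpace ω = S ∧ ω.1 y = 0} := by
  symm
  apply Nat.subtype_card
  intro ω
  simp [mem_flags, and_assoc]

/-- Subspaces of equal dimension are conjugate, so the subspace of a uniform flag is uniform on its
Grassmannian. -/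
lemma card_fiber_eq {S S' : Submodule F (Fin n → F)}
    (h : Module.finrank F S = Module.finrank F S') :
    #{ω ∈ flags F n m | flagSpace ω = S} = #{ω ∈ flags F n m | flagSpace ω = S'} := by
  obtain ⟨g, rfl⟩ := exists_linearEquiv_map_eq h
  have h1 := card_filter_flags (m := m) S 0
  have h2 := card_filter_flags (m := m) (S.map g.toLinearMap) (g 0)
  rw [natCard_flag_eq g] at h1
  simpa using h1.trans h2.symm

lemma card_submodule_eq_pow {k : ℕ} (S : Submodule F (Fin k → F)) :
    #{y : Fin k → F | y ∈ S} = Fintype.card F ^ Module.finrank F S := by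
  rw [← Module.card_eq_pow_finrank (K := F) (V := S), Fintype.card_subtype]

lemma card_ker_eq_pow {ω : ((Fin n → F) →ₗ[F] (Fin m → F)) × (Fin m → F) × (Fin m → F)}
    (hω : IsFlag ω) : #{y : Fin n → F | ω.1 y = 0} = Fintype.card F ^ (n - m) := by
  have h := card_submodule_eq_pow (LinearMap.ker ω.1)
  have h4 := LinearMap.finrank_range_add_finrank_ker ω.1
  rw [LinearMap.range_eq_top.2 hω.1, finrank_top, Module.finrank_fin_fun,
    Module.finrank_fin_fun] at h4
  rw [show Module.finrank F (LinearMap.ker ω.1) = n - m by omega] at h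
  simpa [LinearMap.mem_ker] using h

/-- Conditionally on `S`, the map `ψ` still hashes `S` pairwise almost independently, now into a
plane of `q ^ 2` points. -/
lemma fiber_collision (hmn : m ≤ n) {S : Submodule F (Fin n → F)} {y : Fin n → F} (hy : y ∈ S)
    (hy0 : y ≠ 0) :
    Fintype.card F ^ 2 * #{ω ∈ {ω ∈ flags F n m | flagSpace ω = S} | ω.1 y = 0} ≤
      #{ω ∈ flags F n m | flagSpace ω = S} := by
  by_cases hne : {ω ∈ flags F n m | flagSpace ω = S}.Nonempty
  swap
  · rw [Finset.not_nonempty_iff_eq_empty] at hne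
    simp [hne]
  have hfin : Module.finrank F S = n - m + 2 := by
    obtain ⟨ω, hω⟩ := hne
    rw [mem_filter, mem_flags] at hω
    have := finrank_flagSpace hω.1
    rw [hω.2, Module.finrank_fin_fun, Module.finrank_fin_fun] at this
    omega
  refine mul_card_filter_apply_eq_zero_le (F := F) _ Prod.fst {y : Fin n → F | y ∈ S}
    (Fintype.card F ^ (n - m)) _ (by simp) ?_ ?_ ?_ (by simpa using hy) hy0
  · rw [card_submodule_eq_pow, hfin, pow_add]
  · intro ω hω
    rw [mem_filter, mem_flags] at hω
    rw [← card_ker_eq_pow hω.1, filter_filter]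
    congr 1
    ext x
    simp only [mem_filter, Finset.mem_univ, true_and, and_iff_right_iff_imp]
    intro hx
    rw [← hω.2]
    exact LinearMap.ker_le_comap _ hx
  · intro x hx x' hx' hx0 hx0'
    obtain ⟨g, hg, hgx⟩ := exists_linearEquiv_map_eq_apply_eq (F := F) (S := S)
      (by simpa using hx) (by simpa using hx') hx0 hx0'
    have := natCard_flag_eq (W := Fin m → F) g S x
    rw [hg, hgx] at this
    rw [card_filter_flags, card_filter_flags, this]

lemma flags_collision (hmn : m ≤ n) {y : Fin n → F} (hy0 : y ≠ 0) :
    Fintype.card F ^ m * #{ω ∈ flags F n m | ω.1 y = 0} ≤ #(flags F n m) := by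
  refine mul_card_filter_apply_eq_zero_le (F := F) _ Prod.fst Finset.univ
    (Fintype.card F ^ (n - m)) _ (mem_univ _) ?_ ?_ ?_ (mem_univ _) hy0
  · rw [card_univ, Fintype.card_fun, Fintype.card_fin, ← pow_add]
    congr 1
    omega
  · intro ω hω
    exact card_ker_eq_pow (mem_flags.1 hω)
  · intro x _ x' _ hx0 hx0'
    obtain ⟨g, hgx⟩ := exists_linearEquiv_apply_eq (F := F) hx0 hx0'
    -- The symmetry is stated for a fixed subspace, so the count is split according to `flagSpace`;
    -- `g` permutes the subspaces.
    have key : ∀ z : Fin n → F, #{ω ∈ flags F n m | ω.1 z = 0} =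
        ∑ S : Submodule F (Fin n → F),
          Nat.card {ω : ((Fin n → F) →ₗ[F] (Fin m → F)) × (Fin m → F) × (Fin m → F) //
            IsFlag ω ∧ flagSpace ω = S ∧ ω.1 z = 0} := by
      intro z
      rw [card_eq_sum_card_fiberwise (f := flagSpace) (t := Finset.univ) (by simp)]
      refine sum_congr rfl fun S _ => ?_
      rw [← card_filter_flags, filter_comm]
    rw [key, key]
    let e : Submodule F (Fin n → F) ≃ Submodule F (Fin n → F) :=
      (Submodule.orderIsoMapComap g).toEquiv
    refine Fintype.sum_equiv e _ _ fun S => ?_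
    rw [natCard_flag_eq g, hgx]
    rfl

lemma card_coset_span_pair {u v : Fin m → F} (h : LinearIndependent F ![u, v]) (y₀ : Fin m → F) :
    #{y : Fin m → F | y - y₀ ∈ Submodule.span F {u, v}} = Fintype.card F ^ 2 := by
  have h2 : Module.finrank F (Submodule.span F {u, v}) = 2 := by
    have := finrank_span_eq_card h
    rw [Matrix.range_cons_cons_empty] at this
    simpa using this
  rw [← h2, ← card_submodule_eq_pow]
  refine card_bij (fun y _ => y - y₀) ?_ ?_ ?_
  · intro y hy
    simpa using hy
  · intro y _ y' _ h
    simpa using h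
  · intro y hy
    exact ⟨y + y₀, by simpa using hy, by simp⟩

/-- The number of points of `A` mapped to `y` by `ψ`. -/
noncomputable def fiberCount (A : Finset (Fin n → F)) (ψ : (Fin n → F) →ₗ[F] (Fin m → F))
    (y : Fin m → F) : ℝ := #{x ∈ A | ψ x = y}

/-- The points of `F ^ m` whose fibre count deviates from the mean by at least `t`. -/
noncomputable def badCells (A : Finset (Fin n → F)) (t : ℝ)
    (ψ : (Fin n → F) →ₗ[F] (Fin m → F)) : Finset (Fin m → F) :=
  {y | t ≤ |fiberCount A ψ y - #A / (Fintype.card F : ℝ) ^ m|}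

lemma sum_card_badCells_le (hmn : m ≤ n) (A : Finset (Fin n → F)) {t : ℝ} (ht : 0 ≤ t) :
    (∑ ω ∈ flags F n m, (#(badCells A t ω.1) : ℝ)) * t ^ 2 ≤ #(flags F n m) * #A := by
  have hq : 0 < Fintype.card F := Fintype.card_pos
  have h := sum_sum_sq_card_fiber_sub_le (flags F n m) (fun ω x => ω.1 x) A
    (fun _ => Finset.univ) (Fintype.card F ^ m) (by positivity) (fun _ _ _ _ => Finset.mem_univ _)
    (fun _ _ => by rw [card_univ, Fintype.card_fun, Fintype.card_fin]) (by
      intro x _ x' _ hne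
      have := flags_collision (F := F) hmn (sub_ne_zero.2 hne)
      simpa only [map_sub, sub_eq_zero] using this)
  refine le_trans ?_ h
  rw [sum_mul]
  refine sum_le_sum fun ω _ => ?_
  rw [← nsmul_eq_mul, ← sum_const]
  calc ∑ y ∈ badCells A t ω.1, t ^ 2
      ≤ ∑ y ∈ badCells A t ω.1, (fiberCount A ω.1 y - #A / (Fintype.card F : ℝ) ^ m) ^ 2 := by
        refine sum_le_sum fun y hy => ?_
        rw [badCells, mem_filter] at hy
        rw [← sq_abs (fiberCount A ω.1 y - _)]
        exact pow_le_pow_left₀ ht hy.2 2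
    _ ≤ _ := by
        push_cast
        exact sum_le_sum_of_subset_of_nonneg (Finset.subset_univ _) fun _ _ _ => sq_nonneg _

/-- Inside the coset `x₀ + S` the fibre counts concentrate around their own mean `c`. A cell that is
not bad is within `t` of the global mean, hence at least `d` away from `c`, and the variance bound
makes such cells rare. -/
lemma sum_card_good_le (hmn : m ≤ n) (A : Finset (Fin n → F)) (S : Submodule F (Fin n → F))
    (x₀ : Fin n → F) {t d : ℝ} (hd : 0 ≤ d)
    (hbad : t + d ≤ |(#{a ∈ A | a - x₀ ∈ S} : ℝ) / (Fintype.card F : ℝ) ^ 2 -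
      #A / (Fintype.card F : ℝ) ^ m|) :
    (∑ ω ∈ flags F n m with flagSpace ω = S,
      (#{y ∈ ({y | y - ω.1 x₀ ∈ Submodule.span F {ω.2.1, ω.2.2}} : Finset (Fin m → F)) |
        y ∉ badCells A t ω.1} : ℝ)) * d ^ 2 ≤
      #{ω ∈ flags F n m | flagSpace ω = S} * #{a ∈ A | a - x₀ ∈ S} := by
  have hq : 0 < Fintype.card F := Fintype.card_pos
  have h := sum_sum_sq_card_fiber_sub_le {ω ∈ flags F n m | flagSpace ω = S}
    (fun ω x => ω.1 x) {a ∈ A | a - x₀ ∈ S}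
    (fun ω => {y | y - ω.1 x₀ ∈ Submodule.span F {ω.2.1, ω.2.2}}) (Fintype.card F ^ 2)
    (by positivity) (by
      intro ω hω x hx
      rw [mem_filter] at hω hx ⊢
      refine ⟨Finset.mem_univ _, ?_⟩
      rw [← map_sub]
      have := hx.2
      rw [← hω.2] at this
      exact this) (by
      intro ω hω
      rw [mem_filter, mem_flags] at hω
      exact card_coset_span_pair hω.1.2 _) (by
      intro x hx x' hx' hne
      rw [mem_filter] at hx hx'
      have hS : x - x' ∈ S := by
        have := S.sub_mem hx.2 hx'.2
        rwa [sub_sub_sub_cancel_right] at this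
      have := fiber_collision (F := F) (m := m) hmn hS (sub_ne_zero.2 hne)
      simpa only [map_sub, sub_eq_zero] using this)
  refine le_trans ?_ h
  rw [sum_mul]
  refine sum_le_sum fun ω hω => ?_
  rw [← nsmul_eq_mul, ← sum_const]
  set c : ℝ := (#{a ∈ A | a - x₀ ∈ S} : ℝ) / (Fintype.card F : ℝ) ^ 2 with hc
  have hcount : ∀ y, y - ω.1 x₀ ∈ Submodule.span F {ω.2.1, ω.2.2} →
      fiberCount A ω.1 y = #{x ∈ {a ∈ A | a - x₀ ∈ S} | ω.1 x = y} := by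
    intro y hy
    rw [fiberCount, filter_filter]
    congr 2
    ext x
    simp only [mem_filter]
    refine and_congr_right fun _ => ⟨fun hx => ⟨?_, hx⟩, fun hx => hx.2⟩
    rw [mem_filter] at hω
    rw [← hω.2, flagSpace, Submodule.mem_comap, map_sub, hx]
    exact hy
  push_cast
  refine le_trans (sum_le_sum (g := fun y =>
    ((#{x ∈ {a ∈ A | a - x₀ ∈ S} | ω.1 x = y} : ℝ) - c) ^ 2) fun y hy => ?_)
    (sum_le_sum_of_subset_of_nonneg (filter_subset _ _) fun _ _ _ => sq_nonneg _)
  rw [mem_filter, mem_filter, badCells, mem_filter] at hy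
  rw [← hcount y hy.1.2, ← sq_abs (fiberCount A ω.1 y - c)]
  refine pow_le_pow_left₀ hd ?_ 2
  have h1 : |fiberCount A ω.1 y - #A / (Fintype.card F : ℝ) ^ m| < t := by
    by_contra hlt
    exact hy.2 ⟨Finset.mem_univ _, not_lt.1 hlt⟩
  have h2 := abs_sub_le c (fiberCount A ω.1 y) (#A / (Fintype.card F : ℝ) ^ m)
  rw [abs_sub_comm c (fiberCount A ω.1 y)] at h2
  linarith

/-- Some plane parallel to `u` and `v` has almost all of its points in the set of bad cells. -/
def HasBadPlane (A : Finset (Fin n → F)) (t : ℝ)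
    (ω : ((Fin n → F) →ₗ[F] (Fin m → F)) × (Fin m → F) × (Fin m → F)) : Prop :=
  ∃ a : Fin m → F, (1 - 1 / (4 * n)) * (Fintype.card F : ℝ) ^ 2 ≤
    #{z : Fin 2 → F | a + (z 0 • ω.2.1 + z 1 • ω.2.2) ∈ badCells A t ω.1}

lemma mul_mul_eq_half_mul {k a b w : ℝ} (hk : k ≠ 0) :
    a * (b * w) = a / 2 * (w / (4 * k) * (32 * k * b / 4)) := by
  field_simp
  ring

lemma card_fiber_le_two_mul (hmn : m ≤ n) (hn : 0 < n) (A : Finset (Fin n → F))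
    (S : Submodule F (Fin n → F)) (x₀ : Fin n → F) {μ τ : ℝ} (hτ0 : 0 < τ) (hτ1 : τ < 1)
    (hμ : μ = #A / (Fintype.card F : ℝ) ^ m) (hμn : 64 * n ≤ τ ^ 2 * μ)
    (hbad : τ * μ ≤ |(#{a ∈ A | a - x₀ ∈ S} : ℝ) / (Fintype.card F : ℝ) ^ 2 - μ|) :
    (#{ω ∈ flags F n m | flagSpace ω = S} : ℝ) ≤
      2 * #{ω ∈ flags F n m | flagSpace ω = S ∧ HasBadPlane A (τ * μ / 2) ω} := by
  have hq : (0 : ℝ) < Fintype.card F := by exact_mod_cast (Fintype.card_pos : 0 < Fintype.card F)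
  have hn0 : (0 : ℝ) < n := by exact_mod_cast hn
  set q : ℝ := (Fintype.card F : ℝ) with hqdef
  have hμ0 : 0 < μ := by
    by_contra hle
    have : τ ^ 2 * μ ≤ 0 := mul_nonpos_of_nonneg_of_nonpos (sq_nonneg _) (not_lt.1 hle)
    linarith
  set N : ℝ := (#{a ∈ A | a - x₀ ∈ S} : ℝ) with hN
  set c : ℝ := N / q ^ 2 with hc
  set D : ℝ := |c - μ| with hD
  have hτμ : 0 < τ * μ := by positivity
  have hD0 : 0 < D := by linarith
  have hc0 : 0 ≤ c := by positivity
  -- The variance in the coset is governed by `c`, which may greatly exceed `μ`. If `c ≤ 2μ`, then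
  -- `D ≥ τ μ` suffices; otherwise `D` is at least both `c / 2` and `μ`.
  have hcD : 32 * n * c ≤ D ^ 2 := by
    have hτ2 : τ ^ 2 ≤ 1 := by nlinarith
    rcases le_total c (2 * μ) with h | h
    · calc 32 * n * c ≤ 32 * n * (2 * μ) := by gcongr
        _ = 64 * n * μ := by ring
        _ ≤ τ ^ 2 * μ * μ := by gcongr
        _ = (τ * μ) ^ 2 := by ring
        _ ≤ D ^ 2 := by gcongr
    · have h1 : D = c - μ := abs_of_nonneg (by linarith)
      have h2 : c / 2 ≤ D := by linarith
      have h3 : μ ≤ D := by linarith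
      calc 32 * n * c = 64 * n * (c / 2) := by ring
        _ ≤ τ ^ 2 * μ * (c / 2) := by gcongr
        _ ≤ 1 * D * D := by gcongr
        _ = D ^ 2 := by ring
  have hsum := sum_card_good_le hmn A S x₀ (t := τ * μ / 2) (d := D / 2) (by positivity) (by
    rw [← hμ]
    linarith)
  set T := {ω ∈ flags F n m | flagSpace ω = S} with hT
  have hsplit : #T = #{ω ∈ T | HasBadPlane A (τ * μ / 2) ω} +
      #{ω ∈ T | ¬ HasBadPlane A (τ * μ / 2) ω} :=
    (card_filter_add_card_filter_not _).symm
  -- A flag without a bad plane has at least `q ^ 2 / (4n)` cells that are not bad on the plane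
  -- through `ψ x₀`.
  have hgood : (#{ω ∈ T | ¬ HasBadPlane A (τ * μ / 2) ω} : ℝ) * (q ^ 2 / (4 * n)) ≤
      ∑ ω ∈ T, (#{y ∈ ({y | y - ω.1 x₀ ∈ Submodule.span F {ω.2.1, ω.2.2}} :
        Finset (Fin m → F)) | y ∉ badCells A (τ * μ / 2) ω.1} : ℝ) := by
    rw [← nsmul_eq_mul, ← sum_const]
    refine le_trans (sum_le_sum fun ω hω => ?_)
      (sum_le_sum_of_subset_of_nonneg (filter_subset _ _) fun _ _ _ => Nat.cast_nonneg _)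
    rw [mem_filter, hT, mem_filter, mem_flags] at hω
    by_contra! hlt
    refine hω.2 ⟨ω.1 x₀, ?_⟩
    have h1 := card_coset_span_pair hω.1.1.2 (ω.1 x₀)
    rw [← card_filter_add_card_filter_not (fun y => y ∈ badCells A (τ * μ / 2) ω.1)] at h1
    have h1' : (#{y ∈ ({y | y - ω.1 x₀ ∈ Submodule.span F {ω.2.1, ω.2.2}} :
        Finset (Fin m → F)) | y ∈ badCells A (τ * μ / 2) ω.1} : ℝ) +
        #{y ∈ ({y | y - ω.1 x₀ ∈ Submodule.span F {ω.2.1, ω.2.2}} :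
        Finset (Fin m → F)) | y ∉ badCells A (τ * μ / 2) ω.1} = q ^ 2 := by
      rw [hqdef]
      exact_mod_cast h1
    have h2 : #{y ∈ ({y | y - ω.1 x₀ ∈ Submodule.span F {ω.2.1, ω.2.2}} :
        Finset (Fin m → F)) | y ∈ badCells A (τ * μ / 2) ω.1} ≤
        #{z : Fin 2 → F | ω.1 x₀ + (z 0 • ω.2.1 + z 1 • ω.2.2) ∈ badCells A (τ * μ / 2) ω.1} := by
      apply card_le_card_of_surjOn (fun z : Fin 2 → F => ω.1 x₀ + (z 0 • ω.2.1 + z 1 • ω.2.2))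
      intro y hy
      rw [mem_coe, mem_filter, mem_filter, Submodule.mem_span_pair] at hy
      obtain ⟨⟨-, a, b, hab⟩, hy⟩ := hy
      have hy' : ω.1 x₀ + (a • ω.2.1 + b • ω.2.2) = y := by
        rw [hab]
        abel
      refine ⟨![a, b], ?_, by simpa using hy'⟩
      simpa [hy'] using hy
    have h2' : (#{y ∈ ({y | y - ω.1 x₀ ∈ Submodule.span F {ω.2.1, ω.2.2}} :
        Finset (Fin m → F)) | y ∈ badCells A (τ * μ / 2) ω.1} : ℝ) ≤
        #{z : Fin 2 → F | ω.1 x₀ + (z 0 • ω.2.1 + z 1 • ω.2.2) ∈ badCells A (τ * μ / 2) ω.1} := by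
      exact_mod_cast h2
    have h3 : (1 - 1 / (4 * (n : ℝ))) * q ^ 2 = q ^ 2 - q ^ 2 / (4 * n) := by ring
    rw [← hqdef, h3]
    linarith
  have hT2 : (#{ω ∈ T | ¬ HasBadPlane A (τ * μ / 2) ω} : ℝ) ≤ #T / 2 := by
    have h1 : (#{ω ∈ T | ¬ HasBadPlane A (τ * μ / 2) ω} : ℝ) * (q ^ 2 / (4 * n)) * (D / 2) ^ 2 ≤
        #T * N := (mul_le_mul_of_nonneg_right hgood (sq_nonneg _)).trans hsum
    have h2 : N = c * q ^ 2 := by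
      rw [hc, div_mul_cancel₀ _ (pow_ne_zero 2 hq.ne')]
    have hpos : 0 < q ^ 2 / (4 * n) * (D / 2) ^ 2 := by positivity
    refine le_of_mul_le_mul_right ?_ hpos
    calc _ = (#{ω ∈ T | ¬ HasBadPlane A (τ * μ / 2) ω} : ℝ) * (q ^ 2 / (4 * n)) * (D / 2) ^ 2 := by
          ring
      _ ≤ #T * N := h1
      _ = #T / 2 * (q ^ 2 / (4 * n) * (32 * n * c / 4)) := by
          rw [h2, mul_mul_eq_half_mul hn0.ne']
      _ ≤ #T / 2 * (q ^ 2 / (4 * n) * (D ^ 2 / 4)) :=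
          mul_le_mul_of_nonneg_left (mul_le_mul_of_nonneg_left (by linarith) (by positivity))
            (div_nonneg (Nat.cast_nonneg _) zero_le_two)
      _ = _ := by ring
  have hfin : #{ω ∈ T | HasBadPlane A (τ * μ / 2) ω} =
      #{ω ∈ flags F n m | flagSpace ω = S ∧ HasBadPlane A (τ * μ / 2) ω} := by
    rw [hT, filter_filter]
  rw [← hfin]
  have hsplit' : (#T : ℝ) = #{ω ∈ T | HasBadPlane A (τ * μ / 2) ω} +
      #{ω ∈ T | ¬ HasBadPlane A (τ * μ / 2) ω} := by exact_mod_cast hsplit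
  linarith

lemma exists_isFlag {K : Type*} [Field K] {n m : ℕ} (hmn : m ≤ n) (hm : 2 ≤ m) :
    ∃ ω : ((Fin n → K) →ₗ[K] (Fin m → K)) × (Fin m → K) × (Fin m → K), IsFlag ω := by
  refine ⟨(LinearMap.funLeft K K (Fin.castLE hmn), Pi.single ⟨0, by omega⟩ 1,
    Pi.single ⟨1, by omega⟩ 1), ?_, ?_⟩
  · exact LinearMap.funLeft_surjective_of_injective _ _ _ (Fin.castLE_injective hmn)
  · have h := (Pi.basisFun K (Fin m)).linearIndependent.comp
      ![(⟨0, by omega⟩ : Fin m), ⟨1, by omega⟩] (by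
        intro i j
        fin_cases i <;> fin_cases j <;> simp)
    have h2 : (⇑(Pi.basisFun K (Fin m)) ∘ ![(⟨0, by omega⟩ : Fin m), ⟨1, by omega⟩]) =
        ![Pi.single ⟨0, by omega⟩ 1, Pi.single ⟨1, by omega⟩ 1] := by
      funext i
      fin_cases i <;> simp
    rw [h2] at h
    exact h

/-- The pairs of independent vectors. -/
noncomputable def indepPairs (F : Type*) [Field F] [Fintype F] (m : ℕ) :
    Finset ((Fin m → F) × (Fin m → F)) := {w | LinearIndependent F ![w.1, w.2]}

lemma pow_le_two_mul_card_indepPairs (hm : 2 ≤ m) (hq : 4 ≤ Fintype.card F) :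
    (Fintype.card F : ℝ) ^ (2 * m) ≤ 2 * #(indepPairs F m) := by
  have h := card_linearIndependent (K := F) (V := Fin m → F) (k := 2) (by simpa using hm)
  have h1 : #(indepPairs F m) =
      Nat.card {s : Fin 2 → Fin m → F // LinearIndependent F s} := by
    symm
    rw [← Nat.card_eq_finsetCard]
    refine Nat.card_congr ((finTwoArrowEquiv (Fin m → F)).subtypeEquiv fun s => ?_)
    rw [indepPairs, mem_filter]
    simp only [Finset.mem_univ, true_and]
    rw [show s = ![s 0, s 1] from by funext i; fin_cases i <;> rfl]
    rfl
  rw [h1, h]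
  set q := Fintype.card F with hqdef
  have hq' : (4 : ℝ) ≤ q := by exact_mod_cast hq
  simp only [Fin.prod_univ_two, Module.finrank_fin_fun, Fin.val_zero, Fin.val_one, pow_zero,
    pow_one]
  have hqm : (q : ℝ) ^ 2 ≤ (q : ℝ) ^ m := pow_le_pow_right₀ (by linarith) hm
  have hle : q ≤ q ^ m := Nat.le_self_pow (by omega) q
  rw [Nat.cast_mul, Nat.cast_sub (by omega), Nat.cast_sub hle]
  push_cast
  have h4 : 4 * (q : ℝ) ≤ (q : ℝ) ^ m := by nlinarith
  rw [mul_comm 2 m, pow_mul]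
  nlinarith

/-- The surjective linear maps. -/
noncomputable def surjections (F : Type*) [Field F] [Fintype F] (n m : ℕ) :
    Finset ((Fin n → F) →ₗ[F] (Fin m → F)) :=
  letI : Finite ((Fin n → F) →ₗ[F] (Fin m → F)) := DFunLike.finite _
  {ψ : (Fin n → F) →ₗ[F] (Fin m → F) | Function.Surjective ψ}.toFinite.toFinset

lemma flags_eq_product : flags F n m = surjections F n m ×ˢ indepPairs F m := by
  ext ω
  simp [mem_flags, surjections, indepPairs, IsFlag]

/-- Either at most a proportion `δ / 8` of the `q ^ (2m)` pairs has a bad plane, or the Kakeya bound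
makes the second term at least `1`. Adding the alternatives gives a bound linear in the number of
bad cells, which can be averaged over `ψ`. -/
lemma card_hasBadPlane_le (hmn : m ≤ n) (hn : 0 < n) (A : Finset (Fin n → F)) {δ : ℝ}
    (hδ0 : 0 < δ) (hq : 64 * n ≤ δ * Fintype.card F) (t : ℝ)
    (ψ : (Fin n → F) →ₗ[F] (Fin m → F)) :
    (#{w ∈ indepPairs F m | HasBadPlane A t (ψ, w)} : ℝ) ≤
      (Fintype.card F : ℝ) ^ (2 * m) *
        (δ / 8 + 3 * #(badCells A t ψ) / (Fintype.card F : ℝ) ^ m) := by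
  have hq0 : (0 : ℝ) < Fintype.card F := by
    exact_mod_cast (Fintype.card_pos : 0 < Fintype.card F)
  rcases le_or_gt (#{w ∈ indepPairs F m | HasBadPlane A t (ψ, w)} : ℝ)
    (δ / 8 * (Fintype.card F : ℝ) ^ (2 * m)) with h | h
  · refine h.trans ?_
    rw [mul_comm]
    apply mul_le_mul_of_nonneg_left _ (by positivity)
    have : (0 : ℝ) ≤ 3 * #(badCells A t ψ) / (Fintype.card F : ℝ) ^ m := by positivity
    linarith
  · have h1 := card_pow_le_of_planes hmn hn (badCells A t ψ)
      {w ∈ indepPairs F m | HasBadPlane A t (ψ, w)} hq (fun w hw => by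
        obtain ⟨a, ha⟩ := (mem_filter.1 hw).2
        refine ⟨a, ha.trans (le_of_eq ?_)⟩
        congr!) h
    have h2 : (#{w ∈ indepPairs F m | HasBadPlane A t (ψ, w)} : ℝ) ≤
        (Fintype.card F : ℝ) ^ (2 * m) := by
      have : #{w ∈ indepPairs F m | HasBadPlane A t (ψ, w)} ≤ Fintype.card F ^ (2 * m) := by
        refine (card_le_univ _).trans (le_of_eq ?_)
        rw [Fintype.card_prod, Fintype.card_fun, Fintype.card_fin]
        ring
      exact_mod_cast this
    refine h2.trans (le_mul_of_one_le_right (by positivity) ?_)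
    have : 1 ≤ 3 * (#(badCells A t ψ) : ℝ) / (Fintype.card F : ℝ) ^ m := by
      rwa [le_div_iff₀ (by positivity), one_mul]
    linarith

/-- A large subset of `F ^ n` is equidistributed among the cosets of a random subspace, uniformly
over all cosets. -/
theorem card_bad_lt (hmn : m ≤ n) (hm : 2 ≤ m) (A : Finset (Fin n → F)) {δ τ : ℝ}
    (hδ0 : 0 < δ) (hδ1 : δ < 1) (hτ0 : 0 < τ) (hτ1 : τ < 1)
    (hq : 64 * n < (τ * δ) ^ 2 * Fintype.card F) (hA : Fintype.card F ^ (m + 1) ≤ #A) :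
    (#{S : Submodule F (Fin n → F) | Module.finrank F S + m = n + 2 ∧ ∃ x₀ : Fin n → F,
      τ * (#A / (Fintype.card F : ℝ) ^ m) ≤
        |(#{a ∈ A | a - x₀ ∈ S} : ℝ) / (Fintype.card F : ℝ) ^ 2 -
          #A / (Fintype.card F : ℝ) ^ m|} : ℝ) <
      δ * #{S : Submodule F (Fin n → F) | Module.finrank F S + m = n + 2} := by
  set q : ℝ := (Fintype.card F : ℝ) with hqdef
  set μ : ℝ := #A / q ^ m with hμ
  have hq0 : (0 : ℝ) < q := by
    rw [hqdef]
    exact_mod_cast (Fintype.card_pos : 0 < Fintype.card F)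
  have hn2 : (2 : ℝ) ≤ n := by exact_mod_cast hm.trans hmn
  have hqμ : q ≤ μ := by
    rw [hμ, le_div_iff₀ (by positivity), ← pow_succ']
    rw [hqdef]
    exact_mod_cast hA
  have hμ0 : 0 < μ := hq0.trans_le hqμ
  have hδμ : 64 * n ≤ δ ^ 2 * (τ ^ 2 * μ) := by
    calc 64 * n ≤ (τ * δ) ^ 2 * q := hq.le
      _ ≤ (τ * δ) ^ 2 * μ := by gcongr
      _ = _ := by ring
  have hτμ : 64 * n ≤ τ ^ 2 * μ := by
    refine hδμ.trans (mul_le_of_le_one_left (by positivity) ?_)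
    nlinarith
  have hδq : 64 * n ≤ δ * q := by
    refine hq.le.trans ?_
    gcongr
    nlinarith [mul_pos hτ0 hδ0, mul_lt_mul'' hτ1 hδ1 hτ0.le hδ0.le]
  have hq4 : 4 ≤ Fintype.card F := by
    have : (4 : ℝ) ≤ q := by nlinarith
    rw [hqdef] at this
    exact_mod_cast this
  set t := τ * μ / 2 with ht
  set G : Finset (Submodule F (Fin n → F)) := {S | Module.finrank F S + m = n + 2} with hG
  obtain ⟨ω₀, hω₀⟩ := exists_isFlag (K := F) hmn hm
  have hrank : ∀ ω ∈ flags F n m, flagSpace ω ∈ G := by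
    intro ω hω
    have := finrank_flagSpace (mem_flags.1 hω)
    rw [Module.finrank_fin_fun, Module.finrank_fin_fun] at this
    simpa [hG] using this
  set N := #{ω ∈ flags F n m | flagSpace ω = flagSpace ω₀} with hN
  have hN0 : 0 < N := card_pos.2 ⟨ω₀, by simp [mem_flags, hω₀]⟩
  have hfib : ∀ S ∈ G, #{ω ∈ flags F n m | flagSpace ω = S} = N := by
    intro S hS
    apply card_fiber_eq
    have h1 := hrank ω₀ (mem_flags.2 hω₀)
    rw [hG, mem_filter] at h1 hS
    omega
  have hflags : #(flags F n m) = #G * N := by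
    rw [card_eq_sum_card_fiberwise hrank, sum_congr rfl hfib, sum_const, smul_eq_mul]
  set H := {ω ∈ flags F n m | HasBadPlane A t ω} with hH
  set B : Finset (Submodule F (Fin n → F)) := {S | Module.finrank F S + m = n + 2 ∧
    ∃ x₀ : Fin n → F, τ * μ ≤ |(#{a ∈ A | a - x₀ ∈ S} : ℝ) / q ^ 2 - μ|} with hB
  -- Each subspace with a bad coset contributes at least half of its `N` flags to `H`.
  have hBN : (#B : ℝ) * N ≤ 2 * #H := by
    have h1 : ∀ S ∈ B, (N : ℝ) ≤ 2 * #{ω ∈ H | flagSpace ω = S} := by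
      intro S hS
      rw [hB, mem_filter] at hS
      obtain ⟨-, hS, x₀, hx₀⟩ := hS
      rw [← hfib S (by simpa [hG] using hS)]
      refine (card_fiber_le_two_mul hmn (by omega) A S x₀ hτ0 hτ1 hμ hτμ hx₀).trans
        (le_of_eq ?_)
      congr 3
      ext ω
      simp only [hH, mem_filter]
      tauto
    calc (#B : ℝ) * N = ∑ _S ∈ B, (N : ℝ) := by rw [sum_const, nsmul_eq_mul]
      _ ≤ ∑ S ∈ B, 2 * (#{ω ∈ H | flagSpace ω = S} : ℝ) := sum_le_sum h1
      _ = 2 * ((∑ S ∈ B, #{ω ∈ H | flagSpace ω = S} : ℕ) : ℝ) := by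
          rw [← mul_sum]
          push_cast
          rfl
      _ ≤ 2 * #H := by
          gcongr
          rw [← card_biUnion]
          · refine card_le_card ?_
            intro ω hω
            obtain ⟨S, -, hS⟩ := mem_biUnion.1 hω
            exact (mem_filter.1 hS).1
          · intro S _ S' _ hne
            rw [Function.onFun, Finset.disjoint_left]
            intro ω h1 h2
            exact hne ((mem_filter.1 h1).2.symm.trans (mem_filter.1 h2).2)
  by_contra! hcon
  set Ψ := surjections F n m with hΨ
  set I := indepPairs F m with hI
  have hI0 : (0 : ℝ) < #I := by
    have := pow_le_two_mul_card_indepPairs (F := F) hm hq4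
    have h2 : 0 < q ^ (2 * m) := by positivity
    linarith
  have hΨI : (#(flags F n m) : ℝ) = #Ψ * #I := by
    rw [flags_eq_product, card_product]
    push_cast
    rfl
  have hΨ0 : (0 : ℝ) < #Ψ := by
    have h1 : (0 : ℝ) < #(flags F n m) := by
      exact_mod_cast card_pos.2 ⟨ω₀, mem_flags.2 hω₀⟩
    rw [hΨI] at h1
    exact pos_of_mul_pos_left h1 hI0.le
  have hHsum : (#H : ℝ) = ∑ ψ ∈ Ψ, (#{w ∈ I | HasBadPlane A t (ψ, w)} : ℝ) := by
    rw [hH, flags_eq_product, card_filter, sum_product]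
    push_cast
    refine sum_congr rfl fun ψ _ => ?_
    rw [sum_boole]
  -- With `t = τ μ / 2`, the variance bound gives an average of at most `4 q ^ m / (τ² μ)` bad
  -- cells, and `64 n ≤ δ² τ² μ`.
  have hYsum : (∑ ψ ∈ Ψ, (#(badCells A t ψ) : ℝ)) * (16 * n) ≤ δ ^ 2 * #Ψ * q ^ m := by
    have h1 := sum_card_badCells_le hmn A (t := t) (by positivity)
    rw [hΨI, flags_eq_product, sum_product] at h1
    simp only [sum_const, nsmul_eq_mul] at h1
    rw [← mul_sum] at h1
    have hAμ : (#A : ℝ) = μ * q ^ m := by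
      rw [hμ, div_mul_cancel₀ _ (by positivity)]
    rw [hAμ, ht] at h1
    set Y := ∑ ψ ∈ Ψ, (#(badCells A t ψ) : ℝ) with hY
    have hY0 : 0 ≤ Y := sum_nonneg fun _ _ => Nat.cast_nonneg _
    clear_value Y
    have h2 : (#I * μ) * (Y * (τ ^ 2 * μ)) ≤ (#I * μ) * (4 * (#Ψ * q ^ m)) := by
      calc (#I * μ) * (Y * (τ ^ 2 * μ)) = 4 * (#I * Y * (τ * μ / 2) ^ 2) := by ring
        _ ≤ 4 * (#Ψ * #I * (μ * q ^ m)) := mul_le_mul_of_nonneg_left h1 (by norm_num)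
        _ = _ := by ring
    have h3 := le_of_mul_le_mul_left h2 (mul_pos hI0 hμ0)
    calc Y * (16 * n) = Y * (64 * n) / 4 := by ring
      _ ≤ Y * (δ ^ 2 * (τ ^ 2 * μ)) / 4 := by gcongr
      _ = δ ^ 2 * (Y * (τ ^ 2 * μ)) / 4 := by ring
      _ ≤ δ ^ 2 * (4 * (#Ψ * q ^ m)) / 4 := by gcongr
      _ = _ := by ring
  have hHle : (#H : ℝ) ≤ q ^ (2 * m) * (#Ψ * (δ / 8) + δ ^ 2 * #Ψ * 3 / (16 * n)) := by
    calc (#H : ℝ) ≤ ∑ ψ ∈ Ψ, q ^ (2 * m) * (δ / 8 + 3 * #(badCells A t ψ) / q ^ m) := by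
          rw [hHsum]
          exact sum_le_sum fun ψ _ => card_hasBadPlane_le hmn (by omega) A hδ0 hδq t ψ
      _ = q ^ (2 * m) * (#Ψ * (δ / 8) +
            3 / q ^ m * ∑ ψ ∈ Ψ, (#(badCells A t ψ) : ℝ)) := by
          rw [← mul_sum, sum_add_distrib, sum_const, nsmul_eq_mul, mul_sum]
          congr 2
          refine sum_congr rfl fun ψ _ => ?_
          ring
      _ ≤ _ := by
          apply mul_le_mul_of_nonneg_left _ (by positivity)
          apply add_le_add_right
          rw [le_div_iff₀ (by positivity), mul_assoc, div_mul_eq_mul_div,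
            div_le_iff₀ (by positivity)]
          linarith
  have hlow : δ * (#Ψ * #I) ≤ 2 * #H := by
    refine le_trans ?_ hBN
    rw [← hΨI, hflags]
    push_cast
    rw [← mul_assoc]
    gcongr
  have hI2 : q ^ (2 * m) ≤ 2 * #I := pow_le_two_mul_card_indepPairs hm hq4
  have hqm : 0 < q ^ (2 * m) := by positivity
  -- A proportion at least `δ / 2` of the flags lies in `H`, against the upper bound; `q ^ (2m) ≤ 2
  -- #I` converts all pairs into independent ones, and `1/4 ≤ 1/8 + 3δ/(16n)` is absurd.
  have h1 : (δ * #Ψ * q ^ (2 * m)) * (1 / 4) ≤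
      (δ * #Ψ * q ^ (2 * m)) * (1 / 8 + 3 * δ / (16 * n)) := by
    calc (δ * #Ψ * q ^ (2 * m)) * (1 / 4) ≤ (δ * #Ψ * (2 * #I)) * (1 / 4) := by gcongr
      _ = δ * (#Ψ * #I) / 2 := by ring
      _ ≤ #H := by linarith
      _ ≤ _ := hHle
      _ = _ := by ring
  have h2 := le_of_mul_le_mul_left h1 (by positivity)
  have h3 : 3 * δ / (16 * n) < 1 / 8 := by
    rw [div_lt_iff₀ (by positivity)]
    linarith
  linarith

end Hashing

/-! ### Averaging lattice point counts over translates. -/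

section PointCount

variable {n : ℕ}

lemma finite_inter_of_isBounded (L : Submodule ℤ (EuclideanSpace ℝ (Fin n))) [DiscreteTopology L]
    {K : Set (EuclideanSpace ℝ (Fin n))} (hK : Bornology.IsBounded K)
    (x : EuclideanSpace ℝ (Fin n)) :
    ((L : Set (EuclideanSpace ℝ (Fin n))) ∩ (x +ᵥ K)).Finite := by
  have : DiscreteTopology L.toAddSubgroup := (inferInstance : DiscreteTopology L)
  have hclosed : IsClosed (L.toAddSubgroup : Set (EuclideanSpace ℝ (Fin n))) :=
    AddSubgroup.isClosed_of_discrete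
  rw [inter_comm]
  exact Metric.finite_isBounded_inter_isClosed this.isDiscrete (hK.vadd x) hclosed

/-- Cut `K` along the translates of the fundamental domain and exchange sum and integral. Null
measurability is assumed because a convex set need not be Borel. -/
lemma volume_eq_lintegral_pointCount (L : Submodule ℤ (EuclideanSpace ℝ (Fin n)))
    [DiscreteTopology L] [IsZLattice ℝ L] {K : Set (EuclideanSpace ℝ (Fin n))}
    (hK : Bornology.IsBounded K) (hKm : NullMeasurableSet K volume)
    {D : Set (EuclideanSpace ℝ (Fin n))} (hD : IsAddFundamentalDomain L D volume) :
    volume K = ∫⁻ x in D, (pointCount L K (-x) : ℝ≥0∞) := by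
  have : MeasurableVAdd L (EuclideanSpace ℝ (Fin n)) :=
    (inferInstance : MeasurableVAdd L.toAddSubgroup _)
  have : VAddInvariantMeasure L (EuclideanSpace ℝ (Fin n)) volume :=
    (inferInstance : VAddInvariantMeasure L.toAddSubgroup _ volume)
  have : Countable L := inferInstance
  have hmeas : ∀ g : L, NullMeasurableSet (g +ᵥ K) volume := fun g => hKm.vadd g
  rw [hD.measure_eq_tsum K]
  have h1 : ∀ g : L, volume ((g +ᵥ K) ∩ D) = ∫⁻ x in D, (g +ᵥ K).indicator 1 x := by
    intro g
    rw [lintegral_indicator_one₀ ((hmeas g).mono_ac Measure.restrict_le_self.absolutelyContinuous),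
      Measure.restrict_apply₀ ((hmeas g).mono_ac Measure.restrict_le_self.absolutelyContinuous)]
  simp_rw [h1]
  rw [← lintegral_tsum]
  · refine lintegral_congr fun x => ?_
    have h2 : ∀ g : L, (g +ᵥ K).indicator (1 : EuclideanSpace ℝ (Fin n) → ℝ≥0∞) x =
        {g : L | x ∈ g +ᵥ K}.indicator 1 g := by
      intro g
      simp [indicator]
    simp_rw [h2]
    rw [← tsum_subtype {g : L | x ∈ g +ᵥ K} (1 : L → ℝ≥0∞)]
    simp only [Pi.one_apply]
    rw [ENNReal.tsum_set_one]
    have h3 : {g : L | x ∈ g +ᵥ K}.encard =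
        ((L : Set (EuclideanSpace ℝ (Fin n))) ∩ (-x +ᵥ K)).encard := by
      have hinj : Function.Injective fun g : L => -(g : EuclideanSpace ℝ (Fin n)) := by
        intro g g' h
        exact Subtype.ext (neg_injective h)
      rw [← hinj.encard_image]
      congr 1
      ext y
      simp only [mem_image, mem_ofPred_eq, mem_inter_iff, SetLike.mem_coe,
        mem_vadd_set_iff_neg_vadd_mem]
      constructor
      · rintro ⟨g, hg, rfl⟩
        refine ⟨L.neg_mem g.2, ?_⟩
        rw [neg_neg, vadd_eq_add, ← sub_eq_add_neg]
        rw [show -g +ᵥ x = -(g : EuclideanSpace ℝ (Fin n)) + x from rfl] at hg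
        rwa [neg_add_eq_sub] at hg
      · rintro ⟨hy, hxy⟩
        refine ⟨⟨-y, L.neg_mem hy⟩, ?_, by simp⟩
        rw [show -(⟨-y, L.neg_mem hy⟩ : L) +ᵥ x = -(-y) + x from rfl, neg_neg]
        rwa [neg_neg, vadd_eq_add, add_comm] at hxy
    rw [h3, pointCount, ← (finite_inter_of_isBounded L hK (-x)).cast_ncard_eq]
    rfl
  · intro g
    exact (aemeasurable_indicator_const_iff 1).2
      ((hmeas g).mono_ac Measure.restrict_le_self.absolutelyContinuous)

lemma volume_lt_top_of_isBounded {K : Set (EuclideanSpace ℝ (Fin n))}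
    (hK : Bornology.IsBounded K) : volume K ≠ ∞ := hK.measure_lt_top.ne

lemma mul_covolume_le (L : Submodule ℤ (EuclideanSpace ℝ (Fin n)))
    [DiscreteTopology L] [IsZLattice ℝ L] {K : Set (EuclideanSpace ℝ (Fin n))}
    (hK : Bornology.IsBounded K) (hKm : NullMeasurableSet K volume) (a : ℕ)
    (h : ∀ x, a ≤ pointCount L K x) : a * ZLattice.covolume L ≤ volume.real K := by
  let b := Module.Free.chooseBasis ℤ L
  have hD := ZLattice.isAddFundamentalDomain b volume
  rw [ZLattice.covolume_eq_measure_fundamentalDomain L volume hD]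
  have h1 : (a : ℝ≥0∞) * volume (ZSpan.fundamentalDomain (b.ofZLatticeBasis ℝ)) ≤ volume K := by
    rw [volume_eq_lintegral_pointCount L hK hKm hD, ← setLIntegral_const]
    exact lintegral_mono fun x => Nat.cast_le.2 (h (-x))
  have := ENNReal.toReal_mono (volume_lt_top_of_isBounded hK) h1
  simpa [Measure.real, ENNReal.toReal_mul] using this

lemma le_mul_covolume (L : Submodule ℤ (EuclideanSpace ℝ (Fin n)))
    [DiscreteTopology L] [IsZLattice ℝ L] {K : Set (EuclideanSpace ℝ (Fin n))}
    (hK : Bornology.IsBounded K) (hKm : NullMeasurableSet K volume) (a : ℕ)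
    (h : ∀ x, pointCount L K x ≤ a) : volume.real K ≤ a * ZLattice.covolume L := by
  let b := Module.Free.chooseBasis ℤ L
  have hD := ZLattice.isAddFundamentalDomain b volume
  have hfin : volume (ZSpan.fundamentalDomain (b.ofZLatticeBasis ℝ)) ≠ ∞ :=
    volume_lt_top_of_isBounded (ZSpan.fundamentalDomain_isBounded _)
  rw [ZLattice.covolume_eq_measure_fundamentalDomain L volume hD]
  have h1 : volume K ≤ (a : ℝ≥0∞) * volume (ZSpan.fundamentalDomain (b.ofZLatticeBasis ℝ)) := by
    rw [volume_eq_lintegral_pointCount L hK hKm hD, ← setLIntegral_const]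
    exact lintegral_mono fun x => Nat.cast_le.2 (h (-x))
  have := ENNReal.toReal_mono (ENNReal.mul_ne_top (by simp) hfin) h1
  simpa [Measure.real, ENNReal.toReal_mul] using this

end PointCount

/-! ### Behaviour of counts and covolume under dilation. -/

section Scaling

variable {n : ℕ}

lemma pointCount_smul {c : ℝ} (hc : c ≠ 0) (L : Submodule ℤ (EuclideanSpace ℝ (Fin n)))
    (K : Set (EuclideanSpace ℝ (Fin n))) (x : EuclideanSpace ℝ (Fin n)) :
    pointCount (c • L) K x = pointCount L (c⁻¹ • K) (c⁻¹ • x) := by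
  rw [pointCount, pointCount, Submodule.coe_pointwise_smul]
  have h : c • ((L : Set (EuclideanSpace ℝ (Fin n))) ∩ (c⁻¹ • x +ᵥ c⁻¹ • K)) =
      c • (L : Set (EuclideanSpace ℝ (Fin n))) ∩ (x +ᵥ K) := by
    rw [smul_set_inter₀ hc]
    congr 1
    ext y
    simp only [mem_smul_set_iff_inv_smul_mem₀ hc, mem_vadd_set_iff_neg_vadd_mem,
      mem_smul_set_iff_inv_smul_mem₀ (inv_ne_zero hc), vadd_eq_add, inv_inv, smul_add, smul_neg,
      smul_inv_smul₀ hc]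
  rw [← h, ← image_smul, ncard_image_of_injective _ (smul_right_injective _ hc)]

lemma smul_eq_comap {c : ℝ} (hc : c ≠ 0) (L : Submodule ℤ (EuclideanSpace ℝ (Fin n))) :
    c • L = ZLattice.comap ℝ L
      (ContinuousLinearEquiv.smulLeft (Units.mk0 c⁻¹ (inv_ne_zero hc)) :
        EuclideanSpace ℝ (Fin n) ≃L[ℝ] EuclideanSpace ℝ (Fin n)).toLinearMap := by
  ext x
  rw [← SetLike.mem_coe, ← SetLike.mem_coe, Submodule.coe_pointwise_smul, ZLattice.coe_comap,
    mem_smul_set_iff_inv_smul_mem₀ hc]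
  rfl

lemma discreteTopology_smul {c : ℝ} (hc : c ≠ 0) (L : Submodule ℤ (EuclideanSpace ℝ (Fin n)))
    [DiscreteTopology L] : DiscreteTopology (c • L : Submodule ℤ _) := by
  rw [smul_eq_comap hc]
  infer_instance

lemma isZLattice_smul {c : ℝ} (hc : c ≠ 0) (L : Submodule ℤ (EuclideanSpace ℝ (Fin n)))
    [DiscreteTopology L] [IsZLattice ℝ L] [DiscreteTopology (c • L : Submodule ℤ _)] :
    IsZLattice ℝ (c • L : Submodule ℤ _) where
  span_top := by
    have := (inferInstance : IsZLattice ℝ (ZLattice.comap ℝ L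
      (ContinuousLinearEquiv.smulLeft (Units.mk0 c⁻¹ (inv_ne_zero hc)) :
        EuclideanSpace ℝ (Fin n) ≃L[ℝ] EuclideanSpace ℝ (Fin n)).toLinearMap)).span_top
    rwa [← smul_eq_comap hc] at this

lemma covolume_smul {c : ℝ} (hc : 0 < c) (L : Submodule ℤ (EuclideanSpace ℝ (Fin n)))
    [DiscreteTopology L] [IsZLattice ℝ L] :
    ZLattice.covolume (c • L) = c ^ n * ZLattice.covolume L := by
  have := discreteTopology_smul hc.ne' L
  have := isZLattice_smul hc.ne' L
  let b := (Module.Free.chooseBasis ℤ L)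
  have hb : Fintype.card (Module.Free.ChooseBasisIndex ℤ L) = n := by
    have := Module.finrank_eq_card_basis (b.ofZLatticeBasis ℝ)
    rw [← this, finrank_euclideanSpace_fin]
  classical
  let e : L ≃ₗ[ℤ] (c • L : Submodule ℤ _) :=
    Submodule.equivMapOfInjective (DistribSMul.toLinearMap ℤ _ c)
      (smul_right_injective _ hc.ne') L
  let b' : Module.Basis (Module.Free.ChooseBasisIndex ℤ L) ℤ (c • L : Submodule ℤ _) := b.map e
  have hb' : ((↑) ∘ b' : _ → EuclideanSpace ℝ (Fin n)) = fun i => c • (b i : EuclideanSpace ℝ (Fin n)) := by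
    funext i
    rfl
  rw [ZLattice.covolume_eq_det_mul_measureReal _ volume b' (b.ofZLatticeBasis ℝ),
    ZLattice.covolume_eq_det_mul_measureReal _ volume b (b.ofZLatticeBasis ℝ), hb']
  have h1 : (b.ofZLatticeBasis ℝ).det (fun i => c • (b i : EuclideanSpace ℝ (Fin n))) =
      c ^ n * (b.ofZLatticeBasis ℝ).det ((↑) ∘ b) := by
    have := (b.ofZLatticeBasis ℝ).det.map_smul_univ (fun _ => c) ((↑) ∘ b)
    rw [Finset.prod_const, Finset.card_univ, hb, smul_eq_mul] at this
    exact this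
  rw [h1, abs_mul, abs_of_pos (pow_pos hc n), mul_assoc]

end Scaling

/-! ### Coverings, packings and their radii. -/

section Radii

variable {n : ℕ}

lemma vadd_smul_subset {K : Set (EuclideanSpace ℝ (Fin n))} (hK : Convex ℝ K) {s t : ℝ}
    (hs : 0 ≤ s) (ht : 0 ≤ t) {k : EuclideanSpace ℝ (Fin n)} (hk : k ∈ t • K) :
    k +ᵥ s • K ⊆ (t + s) • K := by
  rw [hK.add_smul ht hs]
  rintro _ ⟨y, hy, rfl⟩
  exact add_mem_add hk hy

/-- `K` need not contain the origin, so dilates are nested only up to translation. Translations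
affect neither coverings nor packings. -/
lemma exists_vadd_smul_subset {K : Set (EuclideanSpace ℝ (Fin n))} (hK : Convex ℝ K)
    (hne : K.Nonempty) {s t : ℝ} (hs : 0 ≤ s) (hst : s ≤ t) :
    ∃ k : EuclideanSpace ℝ (Fin n), k +ᵥ s • K ⊆ t • K := by
  obtain ⟨k, hk⟩ := hne
  refine ⟨(t - s) • k, ?_⟩
  have := vadd_smul_subset hK hs (sub_nonneg.2 hst) (smul_mem_smul_set (a := t - s) hk)
  rwa [sub_add_cancel] at this

lemma IsCovering.mono {L : Submodule ℤ (EuclideanSpace ℝ (Fin n))}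
    {K : Set (EuclideanSpace ℝ (Fin n))} (hK : Convex ℝ K) (hne : K.Nonempty) {s t : ℝ}
    (hs : 0 ≤ s) (hst : s ≤ t) (h : IsCovering L (s • K)) : IsCovering L (t • K) := by
  obtain ⟨k, hk⟩ := exists_vadd_smul_subset hK hne hs hst
  rw [IsCovering, eq_univ_iff_forall] at h ⊢
  intro x
  obtain ⟨l, hl, y, hy, hxy⟩ := h (x - k)
  refine ⟨l, hl, k + y, hk ⟨y, hy, rfl⟩, ?_⟩
  change l + y = x - k at hxy
  change l + (k + y) = x
  rw [add_left_comm, hxy, add_sub_cancel]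

lemma IsPacking.mono {L : Submodule ℤ (EuclideanSpace ℝ (Fin n))}
    {K : Set (EuclideanSpace ℝ (Fin n))} (hK : Convex ℝ K) (hne : K.Nonempty) {s t : ℝ}
    (hs : 0 ≤ s) (hst : s ≤ t) (h : IsPacking L (t • K)) : IsPacking L (s • K) := by
  obtain ⟨k, hk⟩ := exists_vadd_smul_subset hK hne hs hst
  intro l hl l' hl' hne'
  have h1 := h hl hl' hne'
  rw [Function.onFun, disjoint_left] at h1 ⊢
  rintro _ ⟨y, hy, rfl⟩ ⟨y', hy', hyy⟩
  change l' + y' = l + y at hyy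
  refine h1 (a := l + (k + y)) ⟨k + y, hk ⟨y, hy, rfl⟩, rfl⟩
    ⟨k + y', hk ⟨y', hy', rfl⟩, ?_⟩
  change l' + (k + y') = l + (k + y)
  rw [add_left_comm, hyy, add_left_comm]

lemma IsCovering.one_le_pointCount {L : Submodule ℤ (EuclideanSpace ℝ (Fin n))}
    [DiscreteTopology L] {K : Set (EuclideanSpace ℝ (Fin n))} (hKb : Bornology.IsBounded K)
    (h : IsCovering L K) (x : EuclideanSpace ℝ (Fin n)) : 1 ≤ pointCount L K x := by
  rw [pointCount, Nat.one_le_iff_ne_zero, Ne,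
    ncard_eq_zero (finite_inter_of_isBounded L hKb x), ← Ne, ← nonempty_iff_ne_empty]
  rw [IsCovering, eq_univ_iff_forall] at h
  obtain ⟨l, hl, y, hy, hxy⟩ := h (-x)
  change l + y = -x at hxy
  refine ⟨-l, L.neg_mem hl, y, hy, ?_⟩
  change x + y = -l
  rw [eq_neg_iff_add_eq_zero, add_assoc, add_comm y, hxy, add_neg_cancel]

lemma IsPacking.pointCount_le_one {L : Submodule ℤ (EuclideanSpace ℝ (Fin n))}
    {K : Set (EuclideanSpace ℝ (Fin n))} (h : IsPacking L K) (x : EuclideanSpace ℝ (Fin n)) :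
    pointCount L K x ≤ 1 := by
  have hsub : ((L : Set (EuclideanSpace ℝ (Fin n))) ∩ (x +ᵥ K)).Subsingleton := by
    rintro l ⟨hl, k, hk, hkl⟩ l' ⟨hl', k', hk', hkl'⟩
    by_contra hne
    have h1 := h hl hl' hne
    rw [Function.onFun, disjoint_left] at h1
    change x + k = l at hkl
    change x + k' = l' at hkl'
    refine h1 (a := l + k') ⟨k', hk', rfl⟩ ⟨k, hk, ?_⟩
    change l' + k = l + k'
    rw [← hkl, ← hkl']
    abel
  have := encard_le_one_iff_subsingleton.2 hsub
  exact ENat.toNat_le_of_le_natCast this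

/-- A large dilate of a ball inside `K` contains a fundamental parallelepiped. Together with
`exists_isPacking` this keeps the infimum and supremum defining the radii away from default values.
-/
lemma exists_isCovering (L : Submodule ℤ (EuclideanSpace ℝ (Fin n))) [DiscreteTopology L]
    [IsZLattice ℝ L] {K : Set (EuclideanSpace ℝ (Fin n))} (hK : (interior K).Nonempty) :
    ∃ t : ℝ, 0 < t ∧ IsCovering L (t • K) := by
  obtain ⟨k, hk⟩ := hK
  obtain ⟨ε, hε, hball⟩ := Metric.isOpen_iff.1 isOpen_interior k hk
  let b := (Module.Free.chooseBasis ℤ L).ofZLatticeBasis ℝ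
  have hspan : Submodule.span ℤ (range b) = L := Module.Basis.ofZLatticeBasis_span ℝ L _
  set R := ∑ i, ‖b i‖ with hR
  have hR0 : 0 ≤ R := Finset.sum_nonneg fun _ _ => norm_nonneg _
  have ht : 0 < (R + 1) / ε := by positivity
  refine ⟨(R + 1) / ε, ht, ?_⟩
  rw [IsCovering, eq_univ_iff_forall]
  intro x
  set t := (R + 1) / ε with htdef
  set w := ZSpan.fract b (x - t • k) with hw
  have hwR : ‖w‖ ≤ R := ZSpan.norm_fract_le b _
  refine ⟨ZSpan.floor b (x - t • k), ?_, t • (k + t⁻¹ • w), smul_mem_smul_set ?_, ?_⟩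
  · exact hspan.le (ZSpan.floor b (x - t • k)).2
  · apply interior_subset
    apply hball
    rw [Metric.mem_ball, dist_eq_norm, add_sub_cancel_left, norm_smul, norm_inv,
      Real.norm_of_nonneg ht.le, inv_mul_lt_iff₀ ht, htdef, div_mul_cancel₀ _ hε.ne']
    linarith
  · change _ + t • (k + t⁻¹ • w) = x
    rw [smul_add, smul_inv_smul₀ ht.ne', hw, ZSpan.fract_apply]
    abel

lemma exists_isPacking (L : Submodule ℤ (EuclideanSpace ℝ (Fin n))) [DiscreteTopology L]
    {K : Set (EuclideanSpace ℝ (Fin n))} (hK : Bornology.IsBounded K) :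
    ∃ t : ℝ, 0 < t ∧ IsPacking L (t • K) := by
  obtain ⟨R, hR, hKR⟩ := hK.exists_pos_norm_le
  obtain ⟨ε, hε, hball⟩ := Metric.isOpen_iff.1 (isOpen_discrete ({0} : Set L)) 0 rfl
  refine ⟨ε / (4 * R), by positivity, fun l hl l' hl' hne => ?_⟩
  rw [Function.onFun, disjoint_left]
  rintro _ ⟨_, ⟨k, hk, rfl⟩, rfl⟩ ⟨_, ⟨k', hk', rfl⟩, hkk⟩
  change l' + (ε / (4 * R)) • k' = l + (ε / (4 * R)) • k at hkk
  apply hne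
  have h1 : l - l' = (ε / (4 * R)) • (k' - k) := by
    rw [smul_sub, sub_eq_sub_iff_add_eq_add, ← hkk, add_comm]
  have h2 : ‖l - l'‖ < ε := by
    rw [h1, norm_smul, Real.norm_of_nonneg (by positivity)]
    calc ε / (4 * R) * ‖k' - k‖ ≤ ε / (4 * R) * (R + R) := by
          gcongr
          exact (norm_sub_le _ _).trans (add_le_add (hKR _ hk') (hKR _ hk))
      _ = ε / 2 := by
          field_simp
          ring
      _ < ε := by linarith
  have h3 : (⟨l - l', L.sub_mem hl hl'⟩ : L) ∈ ({0} : Set L) := by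
    apply hball
    rw [Metric.mem_ball, dist_zero_right]
    exact h2
  have h4 := congrArg (Subtype.val) (mem_singleton_iff.1 h3)
  exact sub_eq_zero.1 h4

lemma volume_real_smul {t : ℝ} (ht : 0 ≤ t) (K : Set (EuclideanSpace ℝ (Fin n))) :
    volume.real (t • K) = t ^ n * volume.real K := by
  rw [Measure.real, Measure.addHaar_smul, finrank_euclideanSpace_fin, ENNReal.toReal_mul,
    ENNReal.toReal_ofReal (abs_nonneg _), abs_of_nonneg (pow_nonneg ht n), Measure.real]

variable {L : Submodule ℤ (EuclideanSpace ℝ (Fin n))} [DiscreteTopology L] [IsZLattice ℝ L]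
  {K : Set (EuclideanSpace ℝ (Fin n))}

/-- Comparing volumes gives packing radius `≤ 1 / v ≤` covering radius. A ratio at most `ρ` then
forces the covering radius to be at most `ρ / v` and the packing radius at least `1 / (ρ v)`. -/
lemma isCovering_and_isPacking (hn : n ≠ 0) (hL : ZLattice.covolume L = 1) (hKc : Convex ℝ K)
    (hKb : Bornology.IsBounded K) (hKi : (interior K).Nonempty) {ρ v : ℝ} (hρ : 0 < ρ)
    (hratio : coverPackRatio K L ≤ ρ) (hv : 0 < v) (hvol : volume.real K = v ^ n) :
    (∀ t, ρ / v < t → IsCovering L (t • K)) ∧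
      ∀ t, 0 < t → t < 1 / (ρ * v) → IsPacking L (t • K) := by
  have hne : K.Nonempty := hKi.mono interior_subset
  set C := {α : ℝ | 0 < α ∧ IsCovering L (α • K)} with hC
  set P := {α : ℝ | 0 < α ∧ IsPacking L (α • K)} with hP
  have hvs : ∀ α, 0 < α → volume.real (α • K) = (α * v) ^ n := by
    intro α hα
    rw [volume_real_smul hα.le, hvol, mul_pow]
  have hCb : ∀ α ∈ C, 1 / v ≤ α := by
    rintro α ⟨hα, hcov⟩
    have h1 := mul_covolume_le L (hKb.smul₀ α) ((hKc.smul α).nullMeasurableSet volume) 1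
      (hcov.one_le_pointCount (hKb.smul₀ α))
    rw [hL, hvs α hα, Nat.cast_one, one_mul, one_le_pow_iff_of_nonneg (by positivity) hn] at h1
    rwa [div_le_iff₀ hv]
  have hPb : ∀ α ∈ P, α ≤ 1 / v := by
    rintro α ⟨hα, hpack⟩
    have h1 := le_mul_covolume L (hKb.smul₀ α) ((hKc.smul α).nullMeasurableSet volume) 1
      hpack.pointCount_le_one
    rw [hL, hvs α hα, Nat.cast_one, one_mul, pow_le_one_iff_of_nonneg (by positivity) hn] at h1
    rwa [le_div_iff₀ hv]
  obtain ⟨α₀, hα₀⟩ := exists_isCovering L hKi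
  obtain ⟨β₀, hβ₀⟩ := exists_isPacking L hKb
  have hCne : C.Nonempty := ⟨α₀, hα₀⟩
  have hPne : P.Nonempty := ⟨β₀, hβ₀⟩
  have hcov : 1 / v ≤ coveringRadius K L := le_csInf hCne hCb
  have hpack : packingRadius K L ≤ 1 / v := csSup_le hPne hPb
  have hpack0 : 0 < packingRadius K L := hβ₀.1.trans_le (le_csSup ⟨1 / v, hPb⟩ hβ₀)
  have hle : coveringRadius K L ≤ ρ * packingRadius K L := (div_le_iff₀ hpack0).1 hratio
  constructor
  · intro t ht
    have h1 : sInf C < t := by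
      calc sInf C ≤ ρ * packingRadius K L := hle
        _ ≤ ρ * (1 / v) := by gcongr
        _ = ρ / v := by ring
        _ < t := ht
    obtain ⟨α, hα, hαt⟩ := exists_lt_of_csInf_lt hCne h1
    exact hα.2.mono hKc hne hα.1.le hαt.le
  · intro t ht0 ht
    have h1 : t < sSup P := by
      refine ht.trans_le ?_
      have h2 : 1 / v ≤ ρ * packingRadius K L := hcov.trans hle
      calc 1 / (ρ * v) = 1 / v / ρ := by
            rw [div_div, mul_comm]
        _ ≤ packingRadius K L := by
            rw [div_le_iff₀ hρ, mul_comm]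
            exact h2
    obtain ⟨α, hα, hαt⟩ := exists_lt_of_lt_csSup hPne h1
    exact hα.2.mono hKc hne ht0.le hαt.le

end Radii

/-! ### Reduction modulo `p` and the lattices `g π_p⁻¹(S)`. -/

section Reduction

variable {n p : ℕ}

lemma reduction_apply (z : Fin n → ℤ) (i : Fin n) : reduction p n z i = (z i : ZMod p) := rfl

lemma reduction_surjective : Function.Surjective (reduction p n) := by
  intro y
  choose z hz using fun i => ZMod.intCast_surjective (y i)
  exact ⟨z, funext hz⟩

lemma exists_eq_smul_of_reduction_eq_zero {z : Fin n → ℤ} (h : reduction p n z = 0) :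
    ∃ w : Fin n → ℤ, z = (p : ℤ) • w := by
  have h1 : ∀ i, ∃ w : ℤ, z i = p * w := fun i => by
    have := congrFun h i
    rw [reduction_apply, Pi.zero_apply, ZMod.intCast_zmod_eq_zero_iff_dvd] at this
    exact this
  choose w hw using h1
  exact ⟨w, funext hw⟩

variable {L : Submodule ℤ (EuclideanSpace ℝ (Fin n))} (b : Module.Basis (Fin n) ℤ L)

/-- The map `z ↦ g z` from `ℤ ^ n` onto the lattice `L` with basis `b`. -/
noncomputable def latticeMap : (Fin n → ℤ) →ₗ[ℤ] EuclideanSpace ℝ (Fin n) :=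
  L.subtype ∘ₗ b.equivFun.symm.toLinearMap

/-- The lattice `g π_p⁻¹(S)`. -/
noncomputable def subLattice (S : Submodule (ZMod p) (Fin n → ZMod p)) :
    Submodule ℤ (EuclideanSpace ℝ (Fin n)) :=
  ((S.restrictScalars ℤ).comap (reduction p n)).map (latticeMap b)

lemma latticeMap_injective : Function.Injective (latticeMap b) :=
  Subtype.val_injective.comp b.equivFun.symm.injective

lemma latticeMap_mem (z : Fin n → ℤ) : latticeMap b z ∈ L := (b.equivFun.symm z).2

lemma exists_latticeMap_eq {l : EuclideanSpace ℝ (Fin n)} (hl : l ∈ L) :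
    ∃ z, latticeMap b z = l := ⟨b.equivFun ⟨l, hl⟩, by simp [latticeMap]⟩

lemma subLattice_le (S : Submodule (ZMod p) (Fin n → ZMod p)) : subLattice b S ≤ L := by
  rintro _ ⟨z, -, rfl⟩
  exact latticeMap_mem b z

lemma latticeMap_mem_subLattice {S : Submodule (ZMod p) (Fin n → ZMod p)} {z : Fin n → ℤ} :
    latticeMap b z ∈ subLattice b S ↔ reduction p n z ∈ S := by
  constructor
  · rintro ⟨w, hw, hwz⟩
    rw [← latticeMap_injective b hwz]
    exact hw
  · intro h
    exact ⟨z, h, rfl⟩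

lemma discreteTopology_subLattice [DiscreteTopology L]
    (S : Submodule (ZMod p) (Fin n → ZMod p)) : DiscreteTopology (subLattice b S) :=
  DiscreteTopology.of_subset (s := (L : Set (EuclideanSpace ℝ (Fin n)))) inferInstance
    (subLattice_le b S)

lemma isZLattice_subLattice [DiscreteTopology L] [IsZLattice ℝ L] (hp : p ≠ 0)
    (S : Submodule (ZMod p) (Fin n → ZMod p)) [DiscreteTopology (subLattice b S)] :
    IsZLattice ℝ (subLattice b S) where
  span_top := by
    rw [eq_top_iff, ← IsZLattice.span_top (K := ℝ) (L := L), Submodule.span_le]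
    intro l hl
    obtain ⟨z, rfl⟩ := exists_latticeMap_eq b hl
    have hp' : (p : ℝ) ≠ 0 := by exact_mod_cast hp
    have h1 : latticeMap b ((p : ℤ) • z) ∈ subLattice b S := by
      rw [latticeMap_mem_subLattice]
      convert! S.zero_mem
      funext i
      simp [reduction_apply]
    have h2 : latticeMap b z = (p : ℝ)⁻¹ • latticeMap b ((p : ℤ) • z) := by
      rw [map_zsmul, ← Int.cast_smul_eq_zsmul ℝ, Int.cast_natCast, inv_smul_smul₀ hp']
    rw [SetLike.mem_coe, h2]
    exact Submodule.smul_mem _ _ (Submodule.subset_span h1)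

/-- The index of `π_p⁻¹(S)` in `ℤⁿ` is that of `S` in `𝔽_pⁿ`, by surjectivity of the reduction. -/
lemma covolume_subLattice [Fact p.Prime] [DiscreteTopology L] [IsZLattice ℝ L]
    (S : Submodule (ZMod p) (Fin n → ZMod p)) :
    ZLattice.covolume (subLattice b S) =
      (p : ℝ) ^ (n - Module.finrank (ZMod p) S) * ZLattice.covolume L := by
  have hp : p ≠ 0 := (Fact.out : p.Prime).ne_zero
  have := discreteTopology_subLattice b S
  have := isZLattice_subLattice b hp S
  have h := ZLattice.covolume_div_covolume_eq_relIndex' (subLattice b S) L (subLattice_le b S)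
  rw [div_eq_iff (ZLattice.covolume_ne_zero L volume)] at h
  rw [h]
  congr 1
  have h1 : (subLattice b S).toAddSubgroup =
      (S.toAddSubgroup.comap (reduction p n).toAddMonoidHom).map
        (latticeMap b).toAddMonoidHom := rfl
  have h2 : L.toAddSubgroup = (⊤ : AddSubgroup (Fin n → ℤ)).map (latticeMap b).toAddMonoidHom := by
    ext l
    constructor
    · intro hl
      obtain ⟨z, hz⟩ := exists_latticeMap_eq b hl
      exact ⟨z, trivial, hz⟩
    · rintro ⟨z, -, rfl⟩
      exact latticeMap_mem b z
  rw [h1, h2, AddSubgroup.relIndex_map_map_of_injective _ _ (latticeMap_injective b),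
    AddSubgroup.relIndex_top_right, AddSubgroup.index_comap_of_surjective _ reduction_surjective]
  have h3 : S.toAddSubgroup.index = Nat.card ((Fin n → ZMod p) ⧸ S) := rfl
  have h4 := Submodule.finrank_quotient_add_finrank S
  rw [Module.finrank_fin_fun] at h4
  rw [h3, Module.natCard_eq_pow_finrank (K := ZMod p), Nat.card_zmod,
    show Module.finrank (ZMod p) ((Fin n → ZMod p) ⧸ S) = n - Module.finrank (ZMod p) S by omega]
  push_cast
  rfl

-- Two points of `L ∩ s K` congruent modulo `p L` would make two translates of `p⁻¹ s K` meet, so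
-- the packing hypothesis makes reduction injective there. The set `A` depends neither on `l` nor on
-- `S`, and `x₀` does not depend on `S`, so `S` can be random.
open Finset in
open scoped Classical in
lemma exists_finset_reduction [Fact p.Prime] [DiscreteTopology L]
    {K : Set (EuclideanSpace ℝ (Fin n))} (hKb : Bornology.IsBounded K)
    {s : ℝ} (hpack : IsPacking L ((p : ℝ)⁻¹ • s • K)) :
    ∃ A : Finset (Fin n → ZMod p), #A = pointCount L (s • K) 0 ∧
      ∀ l ∈ L, ∃ x₀ : Fin n → ZMod p, ∀ S : Submodule (ZMod p) (Fin n → ZMod p),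
        pointCount (subLattice b S) (s • K) l = #{a ∈ A | a - x₀ ∈ S} := by
  have hp : (p : ℝ) ≠ 0 := by exact_mod_cast (Fact.out : p.Prime).ne_zero
  set Z : Set (Fin n → ℤ) := {z | latticeMap b z ∈ s • K} with hZ
  have hfin := finite_inter_of_isBounded L (hKb.smul₀ s) 0
  have himg : latticeMap b '' Z = (L : Set (EuclideanSpace ℝ (Fin n))) ∩
      ((0 : EuclideanSpace ℝ (Fin n)) +ᵥ s • K) := by
    rw [zero_vadd]
    ext l
    constructor
    · rintro ⟨z, hz, rfl⟩
      exact ⟨latticeMap_mem b z, hz⟩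
    · rintro ⟨hl, hlK⟩
      obtain ⟨z, rfl⟩ := exists_latticeMap_eq b hl
      exact ⟨z, hlK, rfl⟩
  have hZfin : Z.Finite := by
    rw [← himg] at hfin
    exact hfin.of_finite_image (latticeMap_injective b).injOn
  have hinj : Set.InjOn (reduction p n) Z := by
    intro z hz z' hz' h
    obtain ⟨w, hw⟩ := exists_eq_smul_of_reduction_eq_zero (p := p) (z := z - z')
      (by rw [map_sub, h, sub_self])
    by_contra hne
    have hw0 : latticeMap b w ≠ 0 := by
      rw [Ne, map_eq_zero_iff _ (latticeMap_injective b)]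
      rintro rfl
      rw [smul_zero, sub_eq_zero] at hw
      exact hne hw
    have h1 := hpack L.zero_mem (latticeMap_mem b w) hw0.symm
    rw [Function.onFun, Set.disjoint_left] at h1
    refine h1 (a := (p : ℝ)⁻¹ • latticeMap b z) ⟨_, smul_mem_smul_set hz, by simp⟩
      ⟨(p : ℝ)⁻¹ • latticeMap b z', smul_mem_smul_set hz', ?_⟩
    change latticeMap b w + (p : ℝ)⁻¹ • latticeMap b z' = (p : ℝ)⁻¹ • latticeMap b z
    have h2 : latticeMap b z = (p : ℝ) • latticeMap b w + latticeMap b z' := by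
      have h3 := congrArg (latticeMap b) hw
      rw [map_sub, map_zsmul, ← Int.cast_smul_eq_zsmul ℝ, Int.cast_natCast] at h3
      rw [← h3, sub_add_cancel]
    rw [h2, smul_add, inv_smul_smul₀ hp]
  refine ⟨hZfin.toFinset.image (reduction p n), ?_, ?_⟩
  · rw [Finset.card_image_of_injOn (by simpa using hinj), pointCount, ← himg,
      ncard_image_of_injective _ (latticeMap_injective b), ncard_eq_toFinset_card Z hZfin]
  · intro l hl
    obtain ⟨z₀, rfl⟩ := exists_latticeMap_eq b hl
    refine ⟨-reduction p n z₀, fun S => ?_⟩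
    have h1 : ((subLattice b S : Set (EuclideanSpace ℝ (Fin n))) ∩
        (latticeMap b z₀ +ᵥ s • K)) =
        (fun z => latticeMap b (z₀ + z)) '' {z ∈ Z | reduction p n z - -reduction p n z₀ ∈ S} := by
      ext y
      constructor
      · rintro ⟨hy, hyK⟩
        obtain ⟨z, rfl⟩ := exists_latticeMap_eq b (subLattice_le b S hy)
        rw [SetLike.mem_coe, latticeMap_mem_subLattice] at hy
        refine ⟨z - z₀, ⟨?_, ?_⟩, by simp⟩
        · rw [mem_vadd_set_iff_neg_vadd_mem, vadd_eq_add, neg_add_eq_sub, ← map_sub] at hyK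
          exact hyK
        · rwa [map_sub, sub_neg_eq_add, sub_add_cancel]
      · rintro ⟨z, ⟨hz, hzS⟩, rfl⟩
        refine ⟨?_, latticeMap b z, hz, ?_⟩
        · rw [SetLike.mem_coe, latticeMap_mem_subLattice, map_add, add_comm]
          rwa [sub_neg_eq_add] at hzS
        · simp
    have hinj2 : Function.Injective fun z => latticeMap b (z₀ + z) := fun z z' h =>
      add_left_cancel (latticeMap_injective b h)
    rw [pointCount, h1, ncard_image_of_injective _ hinj2, Finset.filter_image,
      Finset.card_image_of_injOn (hinj.mono (by
        intro z hz
        simp only [Finset.coe_filter, Finite.mem_toFinset] at hz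
        exact hz.1)), ← ncard_coe_finset]
    congr 1
    ext z
    simp

end Reduction

/-! ### Comparing arbitrary translates with translates by lattice vectors. -/

section Sandwich

variable {n : ℕ} {L : Submodule ℤ (EuclideanSpace ℝ (Fin n))} {K : Set (EuclideanSpace ℝ (Fin n))}

lemma exists_vadd_smul_subset_of_isCovering (hK : Convex ℝ K) {s α : ℝ} (hs : 0 ≤ s) (hα : 0 ≤ α)
    (hcov : IsCovering L (α • K)) (x : EuclideanSpace ℝ (Fin n)) :
    ∃ l ∈ L, x +ᵥ s • K ⊆ l +ᵥ (s + α) • K := by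
  rw [IsCovering, eq_univ_iff_forall] at hcov
  obtain ⟨l, hl, y, hy, hxy⟩ := hcov x
  change l + y = x at hxy
  refine ⟨l, hl, ?_⟩
  rw [← hxy, ← vadd_eq_add, vadd_assoc, add_comm s]
  exact vadd_set_mono (vadd_smul_subset hK hs hα hy)

lemma exists_vadd_smul_superset_of_isCovering (hK : Convex ℝ K) {s α : ℝ} (hs : 0 ≤ s)
    (hα : 0 ≤ α) (hcov : IsCovering L (α • K)) (x : EuclideanSpace ℝ (Fin n)) :
    ∃ l ∈ L, l +ᵥ s • K ⊆ x +ᵥ (s + α) • K := by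
  rw [IsCovering, eq_univ_iff_forall] at hcov
  obtain ⟨l, hl, y, hy, hxy⟩ := hcov (-x)
  change l + y = -x at hxy
  refine ⟨-l, L.neg_mem hl, ?_⟩
  have h1 : -l = x + y := by
    rw [neg_eq_iff_add_eq_zero, add_left_comm, hxy, add_neg_cancel]
  rw [h1, ← vadd_eq_add, vadd_assoc, add_comm s]
  exact vadd_set_mono (vadd_smul_subset hK hs hα hy)

lemma pointCount_mono [DiscreteTopology L] {K' : Set (EuclideanSpace ℝ (Fin n))}
    (hK' : Bornology.IsBounded K') {x x' : EuclideanSpace ℝ (Fin n)}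
    (h : x +ᵥ K ⊆ x' +ᵥ K') : pointCount L K x ≤ pointCount L K' x' :=
  ncard_le_ncard (inter_subset_inter_right _ h) (finite_inter_of_isBounded L hK' x')

lemma pointCount_of_mem {l : EuclideanSpace ℝ (Fin n)} (hl : l ∈ L) :
    pointCount L K l = pointCount L K 0 := by
  have h : (L : Set (EuclideanSpace ℝ (Fin n))) ∩ (l +ᵥ K) =
      (fun y => l + y) '' ((L : Set (EuclideanSpace ℝ (Fin n))) ∩
        ((0 : EuclideanSpace ℝ (Fin n)) +ᵥ K)) := by
    rw [zero_vadd]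
    ext y
    constructor
    · rintro ⟨hy, k, hk, rfl⟩
      exact ⟨k, ⟨(L.add_mem_iff_right hl).1 hy, hk⟩, rfl⟩
    · rintro ⟨k, ⟨hkL, hk⟩, rfl⟩
      exact ⟨L.add_mem hl hkL, k, hk, rfl⟩
  rw [pointCount, h, ncard_image_of_injective _ (add_right_injective l), pointCount]

variable [DiscreteTopology L] [IsZLattice ℝ L]

/-- The average count over translates of `s K` is its volume. Each translate lies in a lattice
translate of `(s + α) K`, and all of these have the same count. -/
lemma pow_mul_volume_le_pointCount (hL : ZLattice.covolume L = 1) (hK : Convex ℝ K)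
    (hKb : Bornology.IsBounded K) {s α : ℝ} (hs : 0 ≤ s) (hα : 0 ≤ α)
    (hcov : IsCovering L (α • K)) :
    s ^ n * volume.real K ≤ pointCount L ((s + α) • K) 0 := by
  rw [← volume_real_smul hs]
  have := le_mul_covolume L (hKb.smul₀ s) ((hK.smul s).nullMeasurableSet volume)
    (pointCount L ((s + α) • K) 0) (fun x => by
      obtain ⟨l, hl, hsub⟩ := exists_vadd_smul_subset_of_isCovering hK hs hα hcov x
      rw [← pointCount_of_mem hl]
      exact pointCount_mono (hKb.smul₀ _) hsub)
  rwa [hL, mul_one] at this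

lemma pointCount_le_pow_mul_volume (hL : ZLattice.covolume L = 1) (hK : Convex ℝ K)
    (hKb : Bornology.IsBounded K) {s α : ℝ} (hs : 0 ≤ s) (hα : 0 ≤ α)
    (hcov : IsCovering L (α • K)) :
    (pointCount L (s • K) 0 : ℝ) ≤ (s + α) ^ n * volume.real K := by
  rw [← volume_real_smul (add_nonneg hs hα)]
  have := mul_covolume_le L (hKb.smul₀ (s + α)) ((hK.smul (s + α)).nullMeasurableSet volume)
    (pointCount L (s • K) 0) (fun x => by
      obtain ⟨l, hl, hsub⟩ := exists_vadd_smul_superset_of_isCovering hK hs hα hcov x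
      rw [← pointCount_of_mem hl]
      exact pointCount_mono (hKb.smul₀ _) hsub)
  rwa [hL, mul_one] at this

end Sandwich

/-! ### Numerical estimates for `p` and `r`. -/

section Estimates

lemma mul_le_three_halves_pow {n : ℕ} (hn : 26 ≤ n) : 64 * (n : ℝ) ≤ (3 / 2) ^ n := by
  induction n, hn using Nat.le_induction with
  | base => norm_num
  | succ k hk ih =>
    have hk' : (26 : ℝ) ≤ k := by exact_mod_cast hk
    rw [pow_succ]
    push_cast
    linarith

/-- `P ^ (1 / n) / P` decreases in `P`, so `P` may be replaced by its lower bound `X`. The factors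
of `X` are `n`-th powers in disguise: `64 n ≤ (3/2) ^ n`, `ρ² ≤ (2/δ) ^ n`, `(τδ)⁻² ≤ (τδ)⁻ⁿ`. The
constant obtained is `909 / 6400 < 1 / 6`. -/
lemma mul_rpow_div_le {n : ℕ} (hn : 26 ≤ n) {δ τ ρ P : ℝ} (hδ0 : 0 < δ) (hδ1 : δ < 1)
    (hτ0 : 0 < τ) (hτ1 : τ < 1) (hρ : 1 ≤ ρ) (hρ2 : ρ < (2 / δ) ^ ((n : ℝ) / 2))
    (hP : 64 * ρ ^ 2 * n / (τ * δ) ^ 2 < P) :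
    n * (101 / 100 * 3 * ρ ^ 2 * P ^ (1 / (n : ℝ)) / P) ≤ τ / 6 := by
  have hn0 : (0 : ℝ) < n := by
    have : (26 : ℝ) ≤ n := by exact_mod_cast hn
    linarith
  have hτδ : 0 < τ * δ := mul_pos hτ0 hδ0
  have hτδ1 : τ * δ < 1 := by nlinarith
  set X := 64 * ρ ^ 2 * n / (τ * δ) ^ 2 with hX
  have hX0 : 0 < X := by positivity
  have hP0 : 0 < P := hX0.trans hP
  have hρn : ρ ^ 2 ≤ (2 / δ) ^ n := by
    have h1 : ρ ^ 2 ≤ ((2 / δ) ^ ((n : ℝ) / 2)) ^ 2 := by gcongr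
    rwa [← Real.rpow_mul_natCast (by positivity), Nat.cast_ofNat, div_mul_cancel₀ _ two_ne_zero,
      Real.rpow_natCast] at h1
  have hXn : X ≤ (3 / (τ * δ ^ 2)) ^ n := by
    calc X = 64 * n * ρ ^ 2 * (1 / (τ * δ)) ^ 2 := by
          rw [hX]
          field_simp
      _ ≤ (3 / 2) ^ n * (2 / δ) ^ n * (1 / (τ * δ)) ^ n := by
          gcongr
          · exact mul_le_three_halves_pow hn
          · rw [le_div_iff₀ hτδ]
            linarith
          · omega
      _ = (3 / (τ * δ ^ 2)) ^ n := by
          rw [← mul_pow, ← mul_pow]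
          congr 1
          field_simp
  have hXr : X ^ (1 / (n : ℝ)) ≤ 3 / (τ * δ ^ 2) := by
    calc X ^ (1 / (n : ℝ)) ≤ ((3 / (τ * δ ^ 2)) ^ n) ^ (1 / (n : ℝ)) := by gcongr
      _ = 3 / (τ * δ ^ 2) := by
          rw [one_div, Real.pow_rpow_inv_natCast (by positivity) (by omega)]
  have hPX : P ^ (1 / (n : ℝ)) / P ≤ X ^ (1 / (n : ℝ)) / X := by
    rw [← Real.rpow_sub_one hP0.ne', ← Real.rpow_sub_one hX0.ne']
    apply Real.rpow_le_rpow_of_nonpos hX0 hP.le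
    rw [sub_nonpos, div_le_one hn0]
    have : (26 : ℝ) ≤ n := by exact_mod_cast hn
    linarith
  calc n * (101 / 100 * 3 * ρ ^ 2 * P ^ (1 / (n : ℝ)) / P)
      = 303 / 100 * n * ρ ^ 2 * (P ^ (1 / (n : ℝ)) / P) := by ring
    _ ≤ 303 / 100 * n * ρ ^ 2 * (3 / (τ * δ ^ 2) / X) := by
        exact mul_le_mul_of_nonneg_left (hPX.trans (by gcongr)) (by positivity)
    _ = 909 / 6400 * τ := by
        rw [hX]
        field_simp
        norm_num
    _ ≤ τ / 6 := by linarith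

/-- The exponent `r = 3 + ⌈n log(3ρ) / log P⌉` makes `P ^ (r / n)` comparable to
`3 ρ P ^ (3 / n)`. -/
lemma rpow_exponent_bounds {n r : ℕ} (hn : 0 < n) {ρ P : ℝ} (hρ : 1 ≤ ρ) (hP : 1 < P)
    (hr : r = 3 + ⌈(n : ℝ) * Real.log (3 * ρ) / Real.log P⌉₊) :
    3 * ρ * P ^ (3 / (n : ℝ)) ≤ P ^ ((r : ℝ) / n) ∧
      P ^ ((r : ℝ) / n) ≤ 3 * ρ * P ^ (3 / (n : ℝ)) * P ^ (1 / (n : ℝ)) := by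
  have hn0 : (0 : ℝ) < n := by exact_mod_cast hn
  have hP0 : 0 < P := by linarith
  have hlog : 0 < Real.log P := Real.log_pos hP
  have hlogρ : 0 < Real.log (3 * ρ) := Real.log_pos (by linarith)
  set x := (n : ℝ) * Real.log (3 * ρ) / Real.log P with hx
  have hx0 : 0 ≤ x := by positivity
  have hxρ : P ^ (x / n) = 3 * ρ := by
    rw [Real.rpow_def_of_pos hP0, hx]
    have : Real.log P * ((n : ℝ) * Real.log (3 * ρ) / Real.log P / n) = Real.log (3 * ρ) := by
      field_simp
    rw [this, Real.exp_log (by linarith)]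
  have hr' : (r : ℝ) = 3 + (⌈x⌉₊ : ℝ) := by
    rw [hr]
    push_cast
    rfl
  constructor
  · rw [← hxρ, ← Real.rpow_add hP0]
    apply Real.rpow_le_rpow_of_exponent_le hP.le
    rw [← add_div]
    gcongr
    have := Nat.le_ceil x
    linarith
  · rw [← hxρ, ← Real.rpow_add hP0, ← Real.rpow_add hP0]
    apply Real.rpow_le_rpow_of_exponent_le hP.le
    rw [← add_div, ← add_div]
    gcongr
    have := Nat.ceil_lt_add_one hx0
    linarith

/-- From `P ≥ (3ρ)²` the quotient of logarithms is at most `1 / 2`, so `r < n / 2 + 4`. -/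
lemma exponent_lt {n r : ℕ} (hn : 26 ≤ n) {ρ P : ℝ} (hρ : 1 ≤ ρ) (hP : 9 * ρ ^ 2 ≤ P)
    (hr : r = 3 + ⌈(n : ℝ) * Real.log (3 * ρ) / Real.log P⌉₊) : r < n := by
  have hn0 : (26 : ℝ) ≤ n := by exact_mod_cast hn
  have hP1 : 1 < P := by nlinarith
  have hlog : 0 < Real.log P := Real.log_pos hP1
  have hlogρ : 0 < Real.log (3 * ρ) := Real.log_pos (by linarith)
  have h1 : 2 * Real.log (3 * ρ) ≤ Real.log P := by
    have : Real.log ((3 * ρ) ^ 2) ≤ Real.log P := by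
      apply Real.log_le_log (by positivity)
      nlinarith
    rwa [Real.log_pow, Nat.cast_ofNat] at this
  have h2 : (n : ℝ) * Real.log (3 * ρ) / Real.log P ≤ n / 2 := by
    rw [div_le_iff₀ hlog]
    nlinarith
  have h3 := Nat.ceil_lt_add_one (a := (n : ℝ) * Real.log (3 * ρ) / Real.log P) (by positivity)
  have h4 : (r : ℝ) < n := by
    rw [hr]
    push_cast
    linarith
  exact_mod_cast h4

end Estimates

/-! ### The choice of the covering scale `α`. -/

section Parameters

variable {n : ℕ} {L : Submodule ℤ (EuclideanSpace ℝ (Fin n))} {K : Set (EuclideanSpace ℝ (Fin n))}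
  [DiscreteTopology L] [IsZLattice ℝ L]

/-- A covering radius `α` that is negligible against the dilation factor `P ^ (1 - r / n)`, for
which the dilate by the latter is still a packing modulo `P`. -/
lemma exists_parameters (hn : 26 ≤ n) (hL : ZLattice.covolume L = 1) (hK : Convex ℝ K)
    (hKb : Bornology.IsBounded K) (hKi : (interior K).Nonempty) {δ τ ρ P : ℝ}
    (hδ0 : 0 < δ) (hδ1 : δ < 1) (hτ0 : 0 < τ) (hτ1 : τ < 1) (hρ : 1 ≤ ρ)
    (hρ2 : ρ < (2 / δ) ^ ((n : ℝ) / 2)) (hKL : coverPackRatio K L ≤ ρ)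
    (hP : 64 * ρ ^ 2 * n / (τ * δ) ^ 2 < P) (hP1 : 1 < P)
    (hlow : P ^ 3 < volume.real K) (hupp : volume.real K < (5 / 2) ^ n * P ^ 3) {r : ℕ}
    (hr : r = 3 + ⌈(n : ℝ) * Real.log (3 * ρ) / Real.log P⌉₊) {s : ℝ}
    (hs : s = P / P ^ ((r : ℝ) / n)) :
    ∃ α, 0 < α ∧ n * α ≤ τ / 6 * s ∧ IsCovering L (α • K) ∧
      ∀ t, 0 < t → t ≤ s + α → IsPacking L (P⁻¹ • t • K) := by
  have hn0 : (26 : ℝ) ≤ n := by exact_mod_cast hn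
  have hP0 : 0 < P := by linarith
  set a := P ^ (3 / (n : ℝ)) with ha
  have ha0 : 0 < a := by positivity
  have han : a ^ n = P ^ 3 := by
    rw [ha, ← Real.rpow_mul_natCast hP0.le, div_mul_cancel₀ _ (by linarith)]
    exact_mod_cast Real.rpow_natCast P 3
  set v := volume.real K ^ (1 / (n : ℝ)) with hv
  have hV0 : 0 < volume.real K := (by positivity : 0 < P ^ 3).trans hlow
  have hv0 : 0 < v := by positivity
  have hvn : volume.real K = v ^ n := by
    rw [hv, one_div, Real.rpow_inv_natCast_pow hV0.le (by omega)]
  have hav : a < v := lt_of_pow_lt_pow_left₀ n hv0.le (by rwa [han, ← hvn])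
  have hva : v < 5 / 2 * a := lt_of_pow_lt_pow_left₀ n (by positivity) (by
    rwa [mul_pow, han, ← hvn])
  obtain ⟨hc1, hc2⟩ := rpow_exponent_bounds (by omega) hρ hP1 hr
  rw [← ha] at hc1 hc2
  set c := P ^ ((r : ℝ) / n)
  have hc0 : 0 < c := by positivity
  have hs0 : 0 < s := by rw [hs]; positivity
  have hest := mul_rpow_div_le hn hδ0 hδ1 hτ0 hτ1 hρ hρ2 hP
  obtain ⟨hcov, hpack⟩ := isCovering_and_isPacking (by omega) hL hK hKb hKi (by linarith) hKL hv0 hvn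
  -- Coverings are only known strictly above `ρ / v`, whence the factor `101 / 100`. It also fits
  -- the packing condition, since `101/100 * 5/2 < 3` and `v < (5/2) a`.
  have hα : n * (101 / 100 * (ρ / v)) ≤ τ / 6 * s := by
    calc n * (101 / 100 * (ρ / v)) = n * (101 / 100 * ρ * c / P / v) * s := by
          rw [hs]
          field_simp
      _ ≤ n * (101 / 100 * ρ * (3 * ρ * a * P ^ (1 / (n : ℝ))) / P / a) * s := by
          gcongr
      _ = n * (101 / 100 * 3 * ρ ^ 2 * P ^ (1 / (n : ℝ)) / P) * s := by
          field_simp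
      _ ≤ τ / 6 * s := by gcongr
  have hα0 : 0 < 101 / 100 * (ρ / v) := by positivity
  refine ⟨101 / 100 * (ρ / v), hα0, hα, hcov _ ?_, fun t ht0 ht => ?_⟩
  · have : 0 < ρ / v := by positivity
    linarith
  · rw [smul_smul]
    apply hpack _ (by positivity)
    have h1 : 101 / 100 * (ρ / v) ≤ s / 100 := by nlinarith
    calc P⁻¹ * t ≤ P⁻¹ * (101 / 100 * s) := by
          gcongr
          linarith
      _ = 101 / 100 / c := by
          rw [hs]
          field_simp
      _ ≤ 101 / 100 / (3 * ρ * a) := by gcongr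
      _ < 1 / (ρ * v) := by
          rw [div_lt_div_iff₀ (by positivity) (by positivity)]
          nlinarith

end Parameters

/-! ### From counts at lattice vectors to the covering smoothness. -/

section Smoothness

variable {n : ℕ}

lemma coveringSmoothness_le {M : Submodule ℤ (EuclideanSpace ℝ (Fin n))}
    {K : Set (EuclideanSpace ℝ (Fin n))} (hM : ZLattice.covolume M = 1)
    (hV : 0 < volume.real K) {t : ℝ}
    (hlow : ∀ x, (1 - t) * volume.real K ≤ pointCount M K x)
    (hupp : ∀ x, pointCount M K x ≤ (1 + t) * volume.real K) :
    coveringSmoothness K M ≤ ENNReal.ofReal t := by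
  refine iSup_le fun x => ENNReal.ofReal_le_ofReal ?_
  rw [hM, div_one, abs_le]
  have h1 := (le_div_iff₀ hV).2 (hlow x)
  have h2 := (div_le_iff₀ hV).2 (hupp x)
  constructor <;> linarith

/-- The number of points of a lattice in `x + s K` is bounded by the numbers in
`l + (s ± α) K` with `l` in a lattice for which `α K` is covering. -/
lemma coveringSmoothness_smul_le {L M : Submodule ℤ (EuclideanSpace ℝ (Fin n))}
    [DiscreteTopology M] {K : Set (EuclideanSpace ℝ (Fin n))} (hK : Convex ℝ K)
    (hKb : Bornology.IsBounded K) (hV : 0 < volume.real K) {s α : ℝ} (hα : 0 ≤ α) (hαs : α < s)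
    (hcov : IsCovering L (α • K)) (hM : ZLattice.covolume (s⁻¹ • M) = 1) {t : ℝ}
    (hlow : ∀ l ∈ L, (1 - t) * volume.real K ≤ pointCount M ((s - α) • K) l)
    (hupp : ∀ l ∈ L, pointCount M ((s + α) • K) l ≤ (1 + t) * volume.real K) :
    coveringSmoothness K (s⁻¹ • M) ≤ ENNReal.ofReal t := by
  have hs : 0 < s := hα.trans_lt hαs
  have h (x : EuclideanSpace ℝ (Fin n)) :
      pointCount (s⁻¹ • M) K x = pointCount M (s • K) (s • x) := by
    rw [pointCount_smul (inv_ne_zero hs.ne'), inv_inv]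
  refine coveringSmoothness_le hM hV (fun x => ?_) fun x => ?_
  · obtain ⟨l, hl, hsub⟩ :=
      exists_vadd_smul_superset_of_isCovering hK (sub_nonneg.2 hαs.le) hα hcov (s • x)
    rw [sub_add_cancel] at hsub
    rw [h]
    exact (hlow l hl).trans (Nat.cast_le.2 (pointCount_mono (hKb.smul₀ s) hsub))
  · obtain ⟨l, hl, hsub⟩ := exists_vadd_smul_subset_of_isCovering hK hs.le hα hcov (s • x)
    rw [h]
    exact (Nat.cast_le.2 (pointCount_mono (hKb.smul₀ _) hsub)).trans (hupp l hl)

/-- Bernoulli's inequality. The shift is `2 α` because `α` is lost twice: in replacing a translate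
by a lattice translate, and in estimating the size of `A`. -/
lemma one_sub_le_one_sub_pow {s α τ : ℝ} (hα : 0 < α) (hαs : 2 * α ≤ s)
    (h : n * α ≤ τ / 6 * s) : (1 - τ / 3) * s ^ n ≤ (s - 2 * α) ^ n := by
  have hs : 0 < s := by linarith
  have h1 := one_add_mul_le_pow (a := -(2 * α / s)) (by
    rw [neg_le_neg_iff, div_le_iff₀ hs]
    linarith) n
  have h2 : n * (2 * α / s) ≤ τ / 3 := by
    rw [← mul_div_assoc, div_le_iff₀ hs]
    linarith
  have h3 : s - 2 * α = (1 + -(2 * α / s)) * s := by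
    field_simp
    ring
  rw [h3, mul_pow]
  gcongr
  linarith

lemma add_pow_le_one_add {s α τ : ℝ} (hs : 0 < s) (hα : 0 ≤ α) (hτ1 : τ ≤ 1)
    (h : n * α ≤ τ / 6 * s) : (s + 2 * α) ^ n ≤ (1 + τ / 2) * s ^ n := by
  have hτ : 0 ≤ τ := by
    have := (by positivity : 0 ≤ n * α).trans h
    nlinarith
  have h3 : s + 2 * α = (2 * α / s + 1) * s := by
    field_simp
    ring
  rw [h3, mul_pow]
  gcongr
  calc (2 * α / s + 1) ^ n ≤ Real.exp (2 * α / s) ^ n := by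
        gcongr
        exact Real.add_one_le_exp _
    _ = Real.exp (n * (2 * α / s)) := by rw [← Real.exp_nat_mul]
    _ ≤ Real.exp (τ / 3) := by
        apply Real.exp_le_exp.2
        rw [← mul_div_assoc, div_le_iff₀ hs]
        linarith
    _ ≤ 1 / (1 - τ / 3) := by
        rw [le_div_iff₀ (by linarith), ← le_div_iff₀' (Real.exp_pos _), one_div, ← Real.exp_neg]
        linarith [Real.add_one_le_exp (-(τ / 3))]
    _ ≤ 1 + τ / 2 := by
        rw [div_le_iff₀ (by linarith)]
        nlinarith

end Smoothness

/-! ### Assembling the probability bound. -/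

section Main

lemma le_and_le_of_abs_lt {N A q τ : ℝ} {m : ℕ} (hm : 2 ≤ m) (hq : 0 < q)
    (h : |N / q ^ 2 - A / q ^ m| < τ * (A / q ^ m)) :
    (1 - τ) * (A / q ^ (m - 2)) ≤ N ∧ N ≤ (1 + τ) * (A / q ^ (m - 2)) := by
  obtain ⟨k, rfl⟩ := Nat.exists_eq_add_of_le hm
  rw [Nat.add_sub_cancel_left]
  have h1 : A / q ^ (2 + k) = A / q ^ k / q ^ 2 := by
    rw [div_div, ← pow_add, add_comm]
  rw [h1, abs_lt, ← sub_div, ← mul_div_assoc, ← neg_div, div_lt_div_iff_of_pos_right (by positivity),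
    div_lt_div_iff_of_pos_right (by positivity)] at h
  constructor <;> linarith

variable {n p r : ℕ} {L : Submodule ℤ (EuclideanSpace ℝ (Fin n))}

lemma uniformProb_lt [Fact p.Prime] {E : Set (Gr p n r)} {δ : ℝ}
    {B₁ B₂ G : Finset (Submodule (ZMod p) (Fin n → ZMod p))}
    (hG : ∀ S, S ∈ G ↔ Module.finrank (ZMod p) S = r)
    (hE : ∀ S ∈ E, S.1 ∈ B₁ ∨ S.1 ∈ B₂)
    (h₁ : (B₁.card : ℝ) < δ * G.card) (h₂ : (B₂.card : ℝ) < δ * G.card) :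
    uniformProb E < 2 * δ := by
  classical
  have hGr : Nat.card (Gr p n r) = G.card := by
    rw [← ncard_coe_finset, ← Nat.card_coe_set_eq]
    exact Nat.card_congr (Equiv.subtypeEquivRight fun S => (hG S).symm)
  have hEB : (Nat.card E : ℝ) ≤ B₁.card + B₂.card := by
    have h1 : Nat.card E ≤ (B₁ ∪ B₂).card := by
      rw [← ncard_coe_finset, Nat.card_coe_set_eq,
        ← ncard_image_of_injective E (f := fun S : Gr p n r => S.1) Subtype.val_injective]
      refine ncard_le_ncard ?_ (Finset.finite_toSet _)
      rintro _ ⟨S, hS, rfl⟩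
      simpa using hE S hS
    exact_mod_cast h1.trans (Finset.card_union_le _ _)
  -- Strictness in `h₁` excludes an empty Grassmannian, so the quotient defining the probability is
  -- genuine.
  have hG0 : (0 : ℝ) < G.card := by
    rcases G.card.eq_zero_or_pos with h | h
    · rw [h, Nat.cast_zero, mul_zero] at h₁
      exact absurd h₁ (not_lt.2 (Nat.cast_nonneg _))
    · exact_mod_cast h
  rw [uniformProb, hGr, div_lt_iff₀ hG0]
  linarith

variable (b : Module.Basis (Fin n) ℤ L)

lemma smul_superLattice (c : ℝ) (S : Gr p n r) :
    c • superLattice b S = ((p : ℝ) / c)⁻¹ • subLattice b S.1 := by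
  rw [inv_div, div_eq_mul_inv, ← smul_smul]
  rfl

lemma div_rpow_pow (hn : n ≠ 0) (hr : r ≤ n) {P : ℝ} (hP : 0 < P) :
    (P / P ^ ((r : ℝ) / n)) ^ n = P ^ (n - r) := by
  rw [div_pow, ← Real.rpow_mul_natCast hP.le, div_mul_cancel₀ _ (by exact_mod_cast hn),
    Real.rpow_natCast, pow_sub₀ _ hP.ne' hr, div_eq_mul_inv]

lemma covolume_smul_superLattice [Fact p.Prime] [DiscreteTopology L] [IsZLattice ℝ L]
    (hn : n ≠ 0) (hr : r ≤ n) (hL : ZLattice.covolume L = 1) (S : Gr p n r) :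
    ZLattice.covolume ((p : ℝ) ^ ((r : ℝ) / n) • superLattice b S) = 1 := by
  have hp : p ≠ 0 := (Fact.out : p.Prime).ne_zero
  have hp0 : (0 : ℝ) < p := by positivity
  have := discreteTopology_subLattice b S.1
  have := isZLattice_subLattice b hp S.1
  rw [smul_superLattice, covolume_smul (by positivity), covolume_subLattice, hL, mul_one, S.2,
    inv_pow, div_rpow_pow hn hr hp0, inv_mul_cancel₀ (by positivity)]

open Finset in
open scoped Classical in
/-- If neither of the two reductions of `L ∩ (s ± α) K` is hashed badly by `S`, then the lattice
`p ^ (r / n) L(S)` is smooth. -/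
lemma coveringSmoothness_lt [Fact p.Prime] [DiscreteTopology L] [IsZLattice ℝ L]
    (hn : n ≠ 0) (hrn : r ≤ n) (hL : ZLattice.covolume L = 1)
    {K : Set (EuclideanSpace ℝ (Fin n))} (hK : Convex ℝ K) (hKb : Bornology.IsBounded K)
    (hV : 0 < volume.real K) {τ α s : ℝ} (hτ0 : 0 < τ) (hτ1 : τ < 1) (hα0 : 0 < α)
    (hαs : 2 * α ≤ s) (hα : n * α ≤ τ / 6 * s) (hcov : IsCovering L (α • K))
    (hs : s = (p : ℝ) / (p : ℝ) ^ ((r : ℝ) / n)) (S : Gr p n r)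
    {A₁ A₂ : Finset (Fin n → ZMod p)}
    (hA₁ : (#A₁ : ℝ) ≤ (s + 2 * α) ^ n * volume.real K)
    (hA₂ : (s - 2 * α) ^ n * volume.real K ≤ #A₂)
    (h₁ : ∀ l ∈ L, ∃ x₀ : Fin n → ZMod p,
      pointCount (subLattice b S.1) ((s + α) • K) l = #{a ∈ A₁ | a - x₀ ∈ S.1})
    (h₂ : ∀ l ∈ L, ∃ x₀ : Fin n → ZMod p,
      pointCount (subLattice b S.1) ((s - α) • K) l = #{a ∈ A₂ | a - x₀ ∈ S.1})
    (hgood₁ : ∀ x₀, |(#{a ∈ A₁ | a - x₀ ∈ S.1} : ℝ) / (p : ℝ) ^ 2 - #A₁ / (p : ℝ) ^ (n + 2 - r)| <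
      τ * (#A₁ / (p : ℝ) ^ (n + 2 - r)))
    (hgood₂ : ∀ x₀, |(#{a ∈ A₂ | a - x₀ ∈ S.1} : ℝ) / (p : ℝ) ^ 2 - #A₂ / (p : ℝ) ^ (n + 2 - r)| <
      τ * (#A₂ / (p : ℝ) ^ (n + 2 - r))) :
    coveringSmoothness K ((p : ℝ) ^ ((r : ℝ) / n) • superLattice b S) <
      ENNReal.ofReal (2 * τ) := by
  have hp0 : (0 : ℝ) < p := by exact_mod_cast (Fact.out : p.Prime).pos
  have hs0 : 0 < s := by linarith
  have hcovol := covolume_smul_superLattice b hn hrn hL S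
  rw [smul_superLattice, ← hs] at hcovol ⊢
  have := discreteTopology_subLattice b S.1
  have hsn : s ^ n = (p : ℝ) ^ (n + 2 - r - 2) := by
    rw [hs, div_rpow_pow hn hrn hp0]
    congr 1
    omega
  -- Here `1 + t = (1 + τ)(1 + τ / 2)`; `τ < 1` gives `t < 2τ`, and this gap keeps the supremum
  -- strictly below `2τ`.
  refine (coveringSmoothness_smul_le hK hKb hV hα0.le (by linarith) hcov hcovol
    (t := 3 / 2 * τ + τ ^ 2 / 2) (fun l hl => ?_) fun l hl => ?_).trans_lt
    ((ENNReal.ofReal_lt_ofReal_iff (by linarith)).2 (by nlinarith))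
  · obtain ⟨x₀, hx₀⟩ := h₂ l hl
    rw [hx₀]
    refine le_trans ?_ (le_and_le_of_abs_lt (by omega) hp0 (hgood₂ x₀)).1
    have h1 : (1 - τ / 3) * volume.real K ≤ #A₂ / (p : ℝ) ^ (n + 2 - r - 2) := by
      rw [← hsn, le_div_iff₀ (by positivity), mul_right_comm]
      exact (mul_le_mul_of_nonneg_right (one_sub_le_one_sub_pow hα0 hαs hα) hV.le).trans hA₂
    calc (1 - (3 / 2 * τ + τ ^ 2 / 2)) * volume.real K
        ≤ ((1 - τ) * (1 - τ / 3)) * volume.real K := by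
          gcongr
          nlinarith
      _ = (1 - τ) * ((1 - τ / 3) * volume.real K) := mul_assoc _ _ _
      _ ≤ _ := mul_le_mul_of_nonneg_left h1 (by linarith)
  · obtain ⟨x₀, hx₀⟩ := h₁ l hl
    rw [hx₀]
    refine (le_and_le_of_abs_lt (by omega) hp0 (hgood₁ x₀)).2.trans ?_
    have h1 : #A₁ / (p : ℝ) ^ (n + 2 - r - 2) ≤ (1 + τ / 2) * volume.real K := by
      rw [← hsn, div_le_iff₀ (by positivity), mul_right_comm]
      exact hA₁.trans
        (mul_le_mul_of_nonneg_right (add_pow_le_one_add hs0 hα0.le hτ1.le hα) hV.le)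
    calc (1 + τ) * (#A₁ / (p : ℝ) ^ (n + 2 - r - 2))
        ≤ (1 + τ) * ((1 + τ / 2) * volume.real K) :=
          mul_le_mul_of_nonneg_left h1 (by linarith)
      _ = _ := by ring

lemma lt_pow_three_of_rpow_lt {x y : ℝ} (hx : 0 ≤ x) (h : x ^ ((1 : ℝ) / 3) < y) : x < y ^ 3 := by
  calc x = (x ^ ((1 : ℝ) / 3)) ^ 3 := by
        rw [← Real.rpow_mul_natCast hx]
        norm_num
    _ < y ^ 3 := by gcongr

lemma pow_three_lt_of_lt_rpow {x y : ℝ} (hx : 0 ≤ x) (hy : 0 ≤ y) (h : y < x ^ ((1 : ℝ) / 3)) :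
    y ^ 3 < x := by
  calc y ^ 3 < (x ^ ((1 : ℝ) / 3)) ^ 3 := by gcongr
    _ = x := by
        rw [← Real.rpow_mul_natCast hx]
        norm_num

end Main

end SmoothCover

theorem corollary3p5 (n : ℕ) (hn : 25 < n)
    (L : Submodule ℤ (EuclideanSpace ℝ (Fin n))) [DiscreteTopology L] [IsZLattice ℝ L]
    (hL : ZLattice.covolume L = 1)
    (b : Module.Basis (Fin n) ℤ L)
    (δ τ : ℝ) (hδ0 : 0 < δ) (hδ1 : δ < 1) (hτ0 : 0 < τ) (hτ1 : τ < 1)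
    (K : Set (EuclideanSpace ℝ (Fin n)))
    (hKconv : Convex ℝ K) (hKbdd : Bornology.IsBounded K) (hKint : (interior K).Nonempty)
    (ρ : ℝ) (hρ1 : 1 ≤ ρ) (hρ2 : ρ < (2 / δ) ^ ((n : ℝ) / 2))
    (hKL : SmoothCover.coverPackRatio K L ≤ ρ)
    (hvol : Real.exp 1 * 128 ^ 3 * ρ ^ 6 * (1 / (τ * δ)) ^ 6 * (n : ℝ) ^ 3 < volume.real K)
    (p : ℕ) (hp : p.Prime)
    (hp_lower : max (64 * ρ ^ 2 * n / (τ * δ) ^ 2)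
      (((2.5 : ℝ) ^ (-(n : ℝ)) * volume.real K) ^ ((1 : ℝ) / 3)) < (p : ℝ))
    (hp_upper : (p : ℝ) < ((Real.exp 1)⁻¹ * volume.real K) ^ ((1 : ℝ) / 3))
    (r : ℕ) (hr : r = 3 + ⌈(n : ℝ) * Real.log (3 * ρ) / Real.log p⌉₊) :
    r < n ∧
    (∀ S : SmoothCover.Gr p n r, ZLattice.covolume
      ((p : ℝ) ^ ((r : ℝ) / n) • SmoothCover.superLattice b S) = 1) ∧
    SmoothCover.uniformProb {S : SmoothCover.Gr p n r |
      ENNReal.ofReal (2 * τ) ≤ SmoothCover.coveringSmoothness K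
        ((p : ℝ) ^ ((r : ℝ) / n) • SmoothCover.superLattice b S)} < 2 * δ := by
  have := Fact.mk hp
  have hn0 : (26 : ℝ) ≤ n := by exact_mod_cast hn
  have hp1 : (1 : ℝ) < p := by exact_mod_cast hp.one_lt
  have hp0 : (0 : ℝ) < p := by linarith
  have hτδ : 0 < τ * δ := mul_pos hτ0 hδ0
  have hτδ1 : (τ * δ) ^ 2 ≤ 1 := pow_le_one₀ hτδ.le (by nlinarith)
  have hP := (le_max_left _ _).trans_lt hp_lower
  have hPρ : 64 * ρ ^ 2 * n < (τ * δ) ^ 2 * p := by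
    rwa [div_lt_iff₀' (by positivity)] at hP
  have hV0 : 0 ≤ volume.real K := measureReal_nonneg
  -- The factor `2`, available from `e > 2`, later absorbs the loss `1 - τ / 3` in the size of `A₂`.
  have hVlow : 2 * (p : ℝ) ^ 3 < volume.real K := by
    have h1 := SmoothCover.pow_three_lt_of_lt_rpow (by positivity) hp0.le hp_upper
    rw [lt_inv_mul_iff₀ (Real.exp_pos 1)] at h1
    have h2 := Real.exp_one_gt_d9
    have h3 : 2 * (p : ℝ) ^ 3 ≤ Real.exp 1 * (p : ℝ) ^ 3 := by
      gcongr
      linarith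
    linarith
  have hVupp : volume.real K < (5 / 2) ^ n * (p : ℝ) ^ 3 := by
    have h1 := SmoothCover.lt_pow_three_of_rpow_lt (by positivity)
      ((le_max_right _ _).trans_lt hp_lower)
    rw [Real.rpow_neg (by norm_num), Real.rpow_natCast, inv_mul_lt_iff₀ (by positivity)] at h1
    norm_num at h1 ⊢
    exact h1
  have hp3 : 0 < (p : ℝ) ^ 3 := by positivity
  have hrn : r < n := SmoothCover.exponent_lt hn hρ1 (by nlinarith) hr
  refine ⟨hrn, SmoothCover.covolume_smul_superLattice b (by omega) hrn.le hL, ?_⟩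
  set s := (p : ℝ) / (p : ℝ) ^ ((r : ℝ) / n) with hs
  have hs0 : 0 < s := by positivity
  obtain ⟨α, hα0, hα, hcov, hpack⟩ := SmoothCover.exists_parameters hn hL hKconv hKbdd hKint
    hδ0 hδ1 hτ0 hτ1 hρ1 hρ2 hKL hP hp1 (by linarith) hVupp hr hs
  have hαs : 2 * α ≤ s := by nlinarith
  obtain ⟨A₁, hA₁, hl₁⟩ := SmoothCover.exists_finset_reduction b hKbdd
    (hpack (s + α) (by linarith) le_rfl)
  obtain ⟨A₂, hA₂, hl₂⟩ := SmoothCover.exists_finset_reduction b hKbdd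
    (hpack (s - α) (by linarith) (by linarith))
  have hA₁low := SmoothCover.pow_mul_volume_le_pointCount hL hKconv hKbdd hs0.le hα0.le hcov
  have hA₁upp := SmoothCover.pointCount_le_pow_mul_volume hL hKconv hKbdd
    (add_nonneg hs0.le hα0.le) hα0.le hcov
  have hA₂low := SmoothCover.pow_mul_volume_le_pointCount hL hKconv hKbdd
    (s := s - 2 * α) (by linarith) hα0.le hcov
  rw [← hA₁, add_assoc, ← two_mul] at hA₁upp
  rw [← hA₁] at hA₁low
  rw [show s - 2 * α + α = s - α by ring, ← hA₂] at hA₂low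
  -- Since `s ^ n = p ^ (n - r)`, the three extra powers of `p` are two for the plane and one for a
  -- mean fibre count of at least `p`.
  have hsn : s ^ n * (2 * (p : ℝ) ^ 3) = 2 * (p : ℝ) ^ (n + 2 - r + 1) := by
    rw [hs, SmoothCover.div_rpow_pow (by omega) hrn.le hp0, mul_left_comm, ← pow_add]
    congr 2
    omega
  have hsV : 2 * (p : ℝ) ^ (n + 2 - r + 1) ≤ s ^ n * volume.real K := by
    rw [← hsn]
    gcongr
  have hppos : 0 < (p : ℝ) ^ (n + 2 - r + 1) := by positivity
  have hcard₁ : Fintype.card (ZMod p) ^ (n + 2 - r + 1) ≤ A₁.card := by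
    rw [ZMod.card, ← Nat.cast_le (α := ℝ), Nat.cast_pow]
    linarith
  have hcard₂ : Fintype.card (ZMod p) ^ (n + 2 - r + 1) ≤ A₂.card := by
    rw [ZMod.card, ← Nat.cast_le (α := ℝ), Nat.cast_pow]
    have h1 := mul_le_mul_of_nonneg_right
      (SmoothCover.one_sub_le_one_sub_pow hα0 hαs hα) hV0
    nlinarith
  have hq : 64 * (n : ℝ) < (τ * δ) ^ 2 * Fintype.card (ZMod p) := by
    rw [ZMod.card]
    have h1 : 64 * (n : ℝ) ≤ 64 * ρ ^ 2 * n := by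
      gcongr
      nlinarith
    linarith
  have hbad₁ := SmoothCover.card_bad_lt (by omega) (by omega) A₁ hδ0 hδ1 hτ0 hτ1 hq hcard₁
  have hbad₂ := SmoothCover.card_bad_lt (by omega) (by omega) A₂ hδ0 hδ1 hτ0 hτ1 hq hcard₂
  refine SmoothCover.uniformProb_lt (fun S => ?_) (fun S hS => ?_) hbad₁ hbad₂
  · rw [Finset.mem_filter_univ]
    omega
  -- A subspace good for both `A₁` and `A₂` gives smoothness below `2τ`, so every failing `S` lies
  -- in one of the two exceptional sets.
  · by_contra! h
    have hdim : Module.finrank (ZMod p) S.1 + (n + 2 - r) = n + 2 := by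
      rw [S.2]
      omega
    simp only [Finset.mem_filter_univ, not_and, not_exists, not_le, ZMod.card] at h
    exact (SmoothCover.coveringSmoothness_lt b (by omega) hrn.le hL hKconv hKbdd
      (by linarith) hτ0 hτ1 hα0 hαs hα hcov hs S hA₁upp hA₂low
      (fun l hl => (hl₁ l hl).imp fun _ hx => hx S.1)
      (fun l hl => (hl₂ l hl).imp fun _ hx => hx S.1)
      (h.1 hdim) (h.2 hdim)).not_ge hS
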